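/- Let $l,g,\mu>0$, let $\xi:\mathbb R\to\mathbb R$ be twice differentiable with $\ddot\xi$ Lipschitz, and let $t_0\in\mathbb R$. Consider the equations of motion of an inverted pendulum with dry friction and horizontally moving pivot, $$\dot q=p,\qquad \dot p=\frac{\ddot\xi}{l}\sin q-\frac{\mu}{l}\left|\ddot\xi\cos q-lp^2+g\sin q\right|\frac{p}{|p|}-\frac{g}{l}\cos q, \tag{1}$$ where $q$ is the angle between the horizontal line and the rod. Write $f(q,p,t)$ for the right-hand side, defined for $p\ne0$. A solution of (1) on an interval $I$ is a function $x=(q,p):I\to\mathbb R^2$, absolutely continuous on every segment contained in $I$, such that $\dot x(t)\in\Phi(x(t),t)$ for almost every $t\in I$, where $\Phi(x,t)$ is the smallest closed convex set containing all the limit values of $f(x^*,t)$ as $x^*=(q^*,p^*)\to x$ with $p^*\neq0$. Suppose that $\mu|\ddot\xi(t)|<g$ for all $t\ge t_0$. Then there exist $q_0\in(0,\pi)$ and $p_0\in\mathbb R$ such that (1) has a solution $(q(t),p(t))$ on $[t_0,\infty)$ with $q(t_0)=q_0$, $p(t_0)=p_0$; this solution is unique to the right of $t_0$ (every solution of (1)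 on an interval containing $t_0$ with the same initial conditions coincides with it at all times $t\ge t_0$ of that interval); and $q(t)\in(0,\pi)$ for all $t>t_0$. -/

import Mathlib

open Set Filter Topology MeasureTheory

noncomputable section

/-- The Filippov set-valued map of a right-hand side `f` with discontinuity set `M`: at `(x, t)`,
the smallest closed convex set containing all the limit values of `f z t` as `z → x`,
`(z, t) ∉ M`. -/
def filippovMap {E : Type*} [NormedAddCommGroup E] [NormedSpace ℝ E]
    (f : E → ℝ → E) (M : Set (E × ℝ)) (x : E) (t : ℝ) : Set E :=
  closedConvexHull ℝ {y : E | MapClusterPt y (𝓝[{z : E | (z, t) ∉ M}] x) (fun z => f z t)}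

/-- `x` is a solution on the interval `I` of the differential inclusion `x' ∈ F(x, t)`:
it is absolutely continuous on every segment contained in `I`, and it satisfies the inclusion at
almost every point of `I`. -/
structure IsInclusionSolution {E : Type*} [NormedAddCommGroup E] [NormedSpace ℝ E]
    (F : E → ℝ → Set E) (I : Set ℝ) (x : ℝ → E) : Prop where
  interval : I.OrdConnected
  absCont : ∀ a ∈ I, ∀ b ∈ I, AbsolutelyContinuousOnInterval x a b
  inclusion : ∀ᵐ t : ℝ, t ∈ I → ∃ v ∈ F (x t) t, HasDerivAt x v t

/-- The right-hand side of the equations of motion in the variables `(q, p)`, meaningful for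
`p ≠ 0`: `l` is the length of the rod, `g` the gravitational acceleration, `μ` the dry friction
coefficient and `ξ` the law of motion of the pivot point. -/
def pendulumRHS (l g μ : ℝ) (ξ : ℝ → ℝ) (x : ℝ × ℝ) (t : ℝ) : ℝ × ℝ :=
  (x.2,
    deriv (deriv ξ) t / l * Real.sin x.1
      - μ / l * |deriv (deriv ξ) t * Real.cos x.1 - l * x.2 ^ 2 + g * Real.sin x.1|
          * (x.2 / |x.2|)
      - g / l * Real.cos x.1)

/-- The right-hand side `Φ` of the differential inclusion of the pendulum with dry friction; the
discontinuity set is the plane `p = 0`. -/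
def pendulumInclusion (l g μ : ℝ) (ξ : ℝ → ℝ) : ℝ × ℝ → ℝ → Set (ℝ × ℝ) :=
  filippovMap (pendulumRHS l g μ ξ) {z : (ℝ × ℝ) × ℝ | z.1.2 = 0}

end

/-!
The proof is the Ważewski argument: if every motion left `[0, π]`, then the motions starting on a
segment of initial states that joins a state falling to the left with a state falling to the right
would split the segment into two disjoint non-empty open sets.

The argument needs uniqueness to the right and continuous dependence on the initial state, which
hold for the differential inclusion because dry friction is monotone in the velocity
(`FrictionLaw.monotone`): the squared distance of two motions satisfies a differential inequality
`u' ≤ K * u`, and Grönwall's inequality for absolutely continuous functions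
(`AbsolutelyContinuousOnInterval.le_exp_mul`) gives `IsApproxSolution.dist_sq_le`. The friction
coefficient is only locally Lipschitz, as it is quadratic in the velocity; but friction never
accelerates, so velocities are bounded a priori on bounded intervals (`abs_le_speedBound`).

Existence comes from the same estimate. With the sign of the velocity replaced by a continuous
function that differs from it only on `[-ε, ε]`, the equations have classical solutions
(`exists_isApproxSolution`). These obey a friction law relaxed by `ε`, and the estimate for
relaxed laws makes them a uniform Cauchy sequence as `ε → 0`. The limit obeys the exact law
(`exists_isSolution`), which is a description of the Filippov set
(`frictionLaw_of_mem_pendulumInclusion`, `FrictionLaw.mem_pendulumInclusion`).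

The condition `μ * |ξ''| < g` is what makes the two exit sets open. A motion that comes from inside
and reaches `q = 0` has `p ≤ 0` there, and if `p = 0`, then all admissible accelerations are
negative, so that the motion crosses `q = 0` instead of returning
(`IsApproxSolution.eventually_fst_neg`).
-/

/-! ### The friction law, and continuous dependence on the initial state -/

/-- The part of the angular acceleration that is continuous across `p = 0`; `α` is the acceleration
of the pivot. -/
noncomputable def pendulumDrive (l g α q : ℝ) : ℝ :=
  α / l * Real.sin q - g / l * Real.cos q

/-- The modulus of the deceleration caused by sliding dry friction; `α` is the acceleration of the
pivot. -/
noncomputable def frictionCap (l g μ α q p : ℝ) : ℝ :=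
  μ / l * |α * Real.cos q - l * p ^ 2 + g * Real.sin q|

/-- The angular acceleration `d` is compatible, up to an error `ε`, with dry friction at the state
`(q, p)`. The friction deceleration is `w = pendulumDrive l g α q - d`. For `ε = 0` the conditions
say that `w = frictionCap l g μ α q p * s` with `s` in the subdifferential of `|·|` at `p`; for
`ε > 0` they also allow the continuous approximations of the sign function that differ from it only
on `[-ε, ε]`. All three conditions are closed in all the variables and convex in `d`. -/
structure FrictionLaw (l g μ ε α q p d : ℝ) : Prop where
  abs_le : |pendulumDrive l g α q - d| ≤ frictionCap l g μ α q p
  nonneg : 0 ≤ (pendulumDrive l g α q - d) * p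
  cap_mul_le : frictionCap l g μ α q p * (|p| - ε) ≤ (pendulumDrive l g α q - d) * p

/-- `(q, p)` is an absolutely continuous solution on `[t₀, T]` of the equations of the pendulum
whose pivot has the acceleration `a`, with the friction law relaxed by `ε`. For `ε = 0` these are
the solutions of the differential inclusion. -/
structure IsApproxSolution (l g μ ε : ℝ) (a : ℝ → ℝ) (t₀ T : ℝ) (q p : ℝ → ℝ) : Prop where
  absCont_fst : AbsolutelyContinuousOnInterval q t₀ T
  absCont_snd : AbsolutelyContinuousOnInterval p t₀ T
  ae_law : ∀ᵐ t : ℝ, t ∈ Icc t₀ T → HasDerivAt q (p t) t ∧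
    ∃ d, HasDerivAt p d t ∧ FrictionLaw l g μ ε (a t) (q t) (p t) d

/-- Grönwall's inequality for absolutely continuous functions. -/
theorem AbsolutelyContinuousOnInterval.le_exp_mul {u : ℝ → ℝ} {t₀ T K : ℝ}
    (hu : AbsolutelyContinuousOnInterval u t₀ T)
    (hd : ∀ᵐ t : ℝ, t ∈ Icc t₀ T → ∃ d, HasDerivAt u d t ∧ d ≤ K * u t)
    {t : ℝ} (ht : t ∈ Icc t₀ T) : u t ≤ Real.exp (K * (t - t₀)) * u t₀ := by
  have h0T : t₀ ≤ T := ht.1.trans ht.2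
  have hut : AbsolutelyContinuousOnInterval u t₀ t := hu.mono (by
    rw [uIcc_of_le ht.1, uIcc_of_le h0T]; exact Icc_subset_Icc le_rfl ht.2)
  have he : AbsolutelyContinuousOnInterval (fun τ => Real.exp (-K * (τ - t₀))) t₀ t := by
    apply ContDiffOn.absolutelyContinuousOnInterval
    fun_prop
  have hw := he.mul hut
  have hint := hw.integral_deriv_eq_sub
  have hle : ∫ τ in t₀..t, deriv (fun τ => Real.exp (-K * (τ - t₀)) * u τ) τ ≤ 0 := by
    rw [intervalIntegral.integral_of_le ht.1]
    apply integral_nonpos_of_ae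
    rw [EventuallyLE, ae_restrict_iff' measurableSet_Ioc]
    filter_upwards [hd] with τ hτ hmem
    obtain ⟨d, hd1, hd2⟩ := hτ ⟨hmem.1.le, hmem.2.trans ht.2⟩
    have hE : HasDerivAt (fun τ => Real.exp (-K * (τ - t₀)))
        (Real.exp (-K * (τ - t₀)) * (-K * 1)) τ :=
      (((hasDerivAt_id τ).sub_const t₀).const_mul (-K)).exp
    have := (hE.mul hd1).deriv
    simp only [Pi.zero_apply]
    change deriv ((fun τ => Real.exp (-K * (τ - t₀))) * u) τ ≤ 0
    rw [this]
    have hpos := Real.exp_pos (-K * (τ - t₀))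
    nlinarith
  have hfin : Real.exp (-K * (t - t₀)) * u t ≤ u t₀ := by
    have h1 := hint.symm.le.trans hle
    simp only [Pi.mul_apply] at h1
    simp only [sub_self, mul_zero, Real.exp_zero, one_mul] at h1
    linarith
  have hpos := Real.exp_pos (K * (t - t₀))
  have := mul_le_mul_of_nonneg_left hfin hpos.le
  rwa [← mul_assoc, ← Real.exp_add, show K * (t - t₀) + -K * (t - t₀) = 0 by ring, Real.exp_zero,
    one_mul] at this

theorem abs_pendulumDrive_le {l g α A : ℝ} (hl : 0 < l) (hg : 0 < g) (hα : |α| ≤ A) (q : ℝ) :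
    |pendulumDrive l g α q| ≤ (A + g) / l := by
  have e : pendulumDrive l g α q = (α * Real.sin q - g * Real.cos q) / l := by
    unfold pendulumDrive; ring
  rw [e, abs_div, abs_of_pos hl]
  gcongr
  calc |α * Real.sin q - g * Real.cos q| ≤ |α * Real.sin q| + |g * Real.cos q| := abs_sub _ _
    _ = |α| * |Real.sin q| + g * |Real.cos q| := by rw [abs_mul, abs_mul, abs_of_pos hg]
    _ ≤ A * 1 + g * 1 := by
      gcongr
      · exact (abs_nonneg _).trans hα
      · exact Real.abs_sin_le_one q
      · exact Real.abs_cos_le_one q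
    _ = A + g := by ring

theorem abs_sin_sub_sin_le (x y : ℝ) : |Real.sin x - Real.sin y| ≤ |x - y| := by
  have := Real.lipschitzWith_sin.dist_le_mul x y
  simpa [Real.dist_eq] using this

theorem abs_cos_sub_cos_le (x y : ℝ) : |Real.cos x - Real.cos y| ≤ |x - y| := by
  have := Real.lipschitzWith_cos.dist_le_mul x y
  simpa [Real.dist_eq] using this

theorem abs_pendulumDrive_sub_le {l g α A : ℝ} (hl : 0 < l) (hg : 0 < g) (hα : |α| ≤ A)
    (q₁ q₂ : ℝ) :
    |pendulumDrive l g α q₁ - pendulumDrive l g α q₂| ≤ (A + g) / l * |q₁ - q₂| := by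
  have e : pendulumDrive l g α q₁ - pendulumDrive l g α q₂ =
      (α * (Real.sin q₁ - Real.sin q₂) - g * (Real.cos q₁ - Real.cos q₂)) / l := by
    unfold pendulumDrive; ring
  rw [e, abs_div, abs_of_pos hl, div_mul_eq_mul_div]
  gcongr
  calc _ ≤ |α * (Real.sin q₁ - Real.sin q₂)| + |g * (Real.cos q₁ - Real.cos q₂)| := abs_sub _ _
    _ = |α| * |Real.sin q₁ - Real.sin q₂| + g * |Real.cos q₁ - Real.cos q₂| := by
      rw [abs_mul, abs_mul, abs_of_pos hg]
    _ ≤ A * |q₁ - q₂| + g * |q₁ - q₂| :=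
      add_le_add (mul_le_mul hα (abs_sin_sub_sin_le _ _) (abs_nonneg _)
        ((abs_nonneg _).trans hα)) (mul_le_mul_of_nonneg_left (abs_cos_sub_cos_le _ _) hg.le)
    _ = _ := by ring

theorem frictionCap_nonneg {l g μ : ℝ} (hl : 0 < l) (hμ : 0 < μ) (α q p : ℝ) :
    0 ≤ frictionCap l g μ α q p := by
  unfold frictionCap; positivity

theorem frictionCap_le {l g μ α A P q p : ℝ} (hl : 0 < l) (hg : 0 < g) (hμ : 0 < μ)
    (hα : |α| ≤ A) (hp : |p| ≤ P) :
    frictionCap l g μ α q p ≤ μ / l * (A + l * P ^ 2 + g) := by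
  unfold frictionCap
  gcongr
  have hp2 : p ^ 2 ≤ P ^ 2 := by
    rw [← sq_abs p]; gcongr
  calc _ ≤ |α * Real.cos q| + |l * p ^ 2| + |g * Real.sin q| := by
        refine (abs_add_le _ _).trans ?_
        gcongr
        exact abs_sub _ _
    _ = |α| * |Real.cos q| + l * p ^ 2 + g * |Real.sin q| := by
      rw [abs_mul, abs_mul g, abs_of_pos hg, abs_of_nonneg (by positivity : 0 ≤ l * p ^ 2)]
    _ ≤ A * 1 + l * P ^ 2 + g * 1 := by
      gcongr
      · exact (abs_nonneg _).trans hα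
      · exact Real.abs_cos_le_one q
      · exact Real.abs_sin_le_one q
    _ = _ := by ring

theorem abs_frictionCap_sub_le {l g μ α A P q₁ q₂ p₁ p₂ : ℝ} (hl : 0 < l) (hg : 0 < g)
    (hμ : 0 < μ) (hα : |α| ≤ A) (hp₁ : |p₁| ≤ P) (hp₂ : |p₂| ≤ P) :
    |frictionCap l g μ α q₁ p₁ - frictionCap l g μ α q₂ p₂| ≤
      μ * ((A + g) / l) * |q₁ - q₂| + 2 * μ * P * |p₁ - p₂| := by
  unfold frictionCap
  rw [← mul_sub, abs_mul, abs_of_pos (div_pos hμ hl)]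
  have h1 : |(|α * Real.cos q₁ - l * p₁ ^ 2 + g * Real.sin q₁|
      - |α * Real.cos q₂ - l * p₂ ^ 2 + g * Real.sin q₂|)| ≤
      (A + g) * |q₁ - q₂| + l * (2 * P * |p₁ - p₂|) := by
    refine (abs_abs_sub_abs_le_abs_sub _ _).trans ?_
    have e : α * Real.cos q₁ - l * p₁ ^ 2 + g * Real.sin q₁ -
        (α * Real.cos q₂ - l * p₂ ^ 2 + g * Real.sin q₂) =
        α * (Real.cos q₁ - Real.cos q₂) - l * ((p₁ + p₂) * (p₁ - p₂))
          + g * (Real.sin q₁ - Real.sin q₂) := by ring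
    rw [e]
    calc _ ≤ |α * (Real.cos q₁ - Real.cos q₂)| + |l * ((p₁ + p₂) * (p₁ - p₂))|
          + |g * (Real.sin q₁ - Real.sin q₂)| := by
          refine (abs_add_le _ _).trans ?_
          gcongr
          exact abs_sub _ _
      _ = |α| * |Real.cos q₁ - Real.cos q₂| + l * (|p₁ + p₂| * |p₁ - p₂|)
          + g * |Real.sin q₁ - Real.sin q₂| := by
        rw [abs_mul, abs_mul l, abs_mul (p₁ + p₂), abs_mul g, abs_of_pos hg, abs_of_pos hl]
      _ ≤ A * |q₁ - q₂| + l * (2 * P * |p₁ - p₂|) + g * |q₁ - q₂| := by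
        have h2 : |p₁ + p₂| ≤ 2 * P := (abs_add_le _ _).trans (by linarith)
        have h3 := mul_le_mul hα (abs_cos_sub_cos_le q₁ q₂) (abs_nonneg _)
          ((abs_nonneg _).trans hα)
        have h4 := mul_le_mul_of_nonneg_left (abs_sin_sub_sin_le q₁ q₂) hg.le
        have h5 : l * (|p₁ + p₂| * |p₁ - p₂|) ≤ l * (2 * P * |p₁ - p₂|) := by gcongr
        linarith
      _ = _ := by ring
  calc _ ≤ μ / l * ((A + g) * |q₁ - q₂| + l * (2 * P * |p₁ - p₂|)) := by gcongr
    _ = _ := by field_simp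

/-- Dry friction is monotone in the velocity: the term `-(w₁ - w₂) * (p₁ - p₂)`, which the
frictional decelerations `w₁`, `w₂` contribute to the growth of the distance of two motions, is not
positive, except for the errors `ε₁`, `ε₂` and the change of the coefficient `frictionCap`. -/
theorem FrictionLaw.monotone {l g μ α ε₁ ε₂ q₁ q₂ p₁ p₂ d₁ d₂ : ℝ}
    (h₁ : FrictionLaw l g μ ε₁ α q₁ p₁ d₁) (h₂ : FrictionLaw l g μ ε₂ α q₂ p₂ d₂) :
    -(((pendulumDrive l g α q₁ - d₁) - (pendulumDrive l g α q₂ - d₂)) * (p₁ - p₂)) ≤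
      |frictionCap l g μ α q₁ p₁ - frictionCap l g μ α q₂ p₂| * |p₁ - p₂|
        + frictionCap l g μ α q₁ p₁ * ε₁ + frictionCap l g μ α q₂ p₂ * ε₂ := by
  have a1 := h₁.cap_mul_le
  have a2 := h₂.cap_mul_le
  have b1 := h₁.abs_le
  have b2 := h₂.abs_le
  set w₁ := pendulumDrive l g α q₁ - d₁
  set w₂ := pendulumDrive l g α q₂ - d₂
  set c₁ := frictionCap l g μ α q₁ p₁
  set c₂ := frictionCap l g μ α q₂ p₂
  have e1 : w₁ * p₂ ≤ c₁ * |p₂| :=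
    (le_abs_self _).trans (by rw [abs_mul]; exact mul_le_mul_of_nonneg_right b1 (abs_nonneg _))
  have e2 : w₂ * p₁ ≤ c₂ * |p₁| :=
    (le_abs_self _).trans (by rw [abs_mul]; exact mul_le_mul_of_nonneg_right b2 (abs_nonneg _))
  have e3 : -((c₁ - c₂) * (|p₁| - |p₂|)) ≤ |c₁ - c₂| * |p₁ - p₂| := by
    refine (neg_le_abs _).trans ?_
    rw [abs_mul]
    exact mul_le_mul_of_nonneg_left (abs_abs_sub_abs_le_abs_sub _ _) (abs_nonneg _)
  nlinarith

theorem sq_add_sq_le_exp_mul {p : ℝ → ℝ} {t₀ T B : ℝ}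
    (hp : AbsolutelyContinuousOnInterval p t₀ T)
    (hd : ∀ᵐ t : ℝ, t ∈ Icc t₀ T → ∃ d, HasDerivAt p d t ∧ d * p t ≤ B * |p t|)
    {t : ℝ} (ht : t ∈ Icc t₀ T) :
    p t ^ 2 + B ^ 2 ≤ Real.exp (t - t₀) * (p t₀ ^ 2 + B ^ 2) := by
  have hu : AbsolutelyContinuousOnInterval (fun t => p t ^ 2 + B ^ 2) t₀ T := by
    have h1 := hp.mul hp
    have h2 : AbsolutelyContinuousOnInterval (fun _ : ℝ => B ^ 2) t₀ T :=
      ContDiffOn.absolutelyContinuousOnInterval contDiffOn_const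
    convert! h1.add h2 using 2
    simp [sq]
  have := hu.le_exp_mul (K := 1) (by
    filter_upwards [hd] with τ hτ hm
    obtain ⟨d, h1, h2⟩ := hτ hm
    refine ⟨_, (h1.pow 2).add_const _, ?_⟩
    simp only [Nat.cast_ofNat, Nat.add_one_sub_one, pow_one, one_mul]
    have : |p τ| ^ 2 = p τ ^ 2 := sq_abs _
    nlinarith [sq_nonneg (|p τ| - B)]) ht
  simpa using this

/-- Friction never accelerates, so a bound on the drive bounds the growth of the velocity. -/
theorem FrictionLaw.mul_le {l g μ α A ε q p d : ℝ} (hl : 0 < l) (hg : 0 < g) (hα : |α| ≤ A)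
    (h : FrictionLaw l g μ ε α q p d) : d * p ≤ (A + g) / l * |p| := by
  have h1 := h.nonneg
  have h2 : pendulumDrive l g α q * p ≤ (A + g) / l * |p| := by
    refine (le_abs_self _).trans ?_
    rw [abs_mul]
    gcongr
    exact abs_pendulumDrive_le hl hg hα q
  nlinarith

/-- An upper bound, on an interval of length `τ`, for the velocity of a pendulum with initial
velocity at most `R` and drive at most `B`. -/
noncomputable def speedBound (R B τ : ℝ) : ℝ := Real.exp τ * (R ^ 2 + B ^ 2) + 1

theorem speedBound_pos (R B τ : ℝ) : 0 < speedBound R B τ := by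
  unfold speedBound; positivity

theorem abs_le_speedBound {p : ℝ → ℝ} {t₀ T B R : ℝ}
    (hp : AbsolutelyContinuousOnInterval p t₀ T)
    (hd : ∀ᵐ t : ℝ, t ∈ Icc t₀ T → ∃ d, HasDerivAt p d t ∧ d * p t ≤ B * |p t|)
    (h0 : |p t₀| ≤ R) {t : ℝ} (ht : t ∈ Icc t₀ T) : |p t| ≤ speedBound R B (T - t₀) := by
  have h := sq_add_sq_le_exp_mul hp hd ht
  have h1 : p t₀ ^ 2 ≤ R ^ 2 := by rw [← sq_abs]; gcongr
  have h2 : Real.exp (t - t₀) * (p t₀ ^ 2 + B ^ 2) ≤ Real.exp (T - t₀) * (R ^ 2 + B ^ 2) := by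
    gcongr; exact ht.2
  have h3 : 0 ≤ Real.exp (T - t₀) * (R ^ 2 + B ^ 2) := by positivity
  apply abs_le_of_sq_le_sq _ (speedBound_pos _ _ _).le
  unfold speedBound
  nlinarith [sq_nonneg B]

theorem IsApproxSolution.abs_snd_le {l g μ ε A R t₀ T : ℝ} {a q p : ℝ → ℝ} (hl : 0 < l)
    (hg : 0 < g) (hA : ∀ t ∈ Icc t₀ T, |a t| ≤ A) (h : IsApproxSolution l g μ ε a t₀ T q p)
    (h0 : |p t₀| ≤ R) {t : ℝ} (ht : t ∈ Icc t₀ T) :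
    |p t| ≤ speedBound R ((A + g) / l) (T - t₀) := by
  refine abs_le_speedBound h.absCont_snd ?_ h0 ht
  filter_upwards [h.ae_law] with τ hτ hm
  obtain ⟨-, d, h1, h2⟩ := hτ hm
  exact ⟨d, h1, h2.mul_le hl hg (hA τ hm)⟩

/-- Motions depend continuously on the initial state and on the relaxation of the friction law,
forward in time. The differential inequality uses the one-sided Lipschitz condition
`FrictionLaw.monotone`. -/
theorem IsApproxSolution.dist_sq_le {l g μ ε₁ ε₂ A P t₀ T : ℝ} {a q₁ p₁ q₂ p₂ : ℝ → ℝ}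
    (hl : 0 < l) (hg : 0 < g) (hμ : 0 < μ) (hε₁ : 0 ≤ ε₁) (hε₂ : 0 ≤ ε₂)
    (hA : ∀ t ∈ Icc t₀ T, |a t| ≤ A)
    (h₁ : IsApproxSolution l g μ ε₁ a t₀ T q₁ p₁) (h₂ : IsApproxSolution l g μ ε₂ a t₀ T q₂ p₂)
    (hP₁ : ∀ t ∈ Icc t₀ T, |p₁ t| ≤ P) (hP₂ : ∀ t ∈ Icc t₀ T, |p₂ t| ≤ P)
    {t : ℝ} (ht : t ∈ Icc t₀ T) :
    (q₁ t - q₂ t) ^ 2 + (p₁ t - p₂ t) ^ 2 ≤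
      Real.exp ((1 + (1 + μ) * ((A + g) / l) + 4 * μ * P) * (t - t₀)) *
        ((q₁ t₀ - q₂ t₀) ^ 2 + (p₁ t₀ - p₂ t₀) ^ 2 +
          2 * (μ / l * (A + l * P ^ 2 + g)) * (ε₁ + ε₂)) := by
  set B := (A + g) / l with hB
  set H := μ / l * (A + l * P ^ 2 + g) with hH
  set K := 1 + (1 + μ) * B + 4 * μ * P with hK
  have hA0 : 0 ≤ A := (abs_nonneg _).trans (hA t ht)
  have hP0 : 0 ≤ P := (abs_nonneg _).trans (hP₁ t ht)
  have hB0 : 0 ≤ B := by positivity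
  have hH0 : 0 ≤ H := by positivity
  have hdq := h₁.absCont_fst.sub h₂.absCont_fst
  have hdp := h₁.absCont_snd.sub h₂.absCont_snd
  have hc : AbsolutelyContinuousOnInterval (fun _ : ℝ => 2 * H * (ε₁ + ε₂)) t₀ T :=
    ContDiffOn.absolutelyContinuousOnInterval contDiffOn_const
  have hu : AbsolutelyContinuousOnInterval
      (fun t => (q₁ t - q₂ t) ^ 2 + (p₁ t - p₂ t) ^ 2 + 2 * H * (ε₁ + ε₂)) t₀ T := by
    convert! ((hdq.mul hdq).add (hdp.mul hdp)).add hc using 2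
    simp [sq]
  have key := hu.le_exp_mul (K := K) (by
    filter_upwards [h₁.ae_law, h₂.ae_law] with τ hτ₁ hτ₂ hm
    obtain ⟨hq₁, d₁, hp₁, hw₁⟩ := hτ₁ hm
    obtain ⟨hq₂, d₂, hp₂, hw₂⟩ := hτ₂ hm
    refine ⟨_, (((hq₁.sub hq₂).pow 2).add ((hp₁.sub hp₂).pow 2)).add_const _, ?_⟩
    simp only [Nat.cast_ofNat, Nat.add_one_sub_one, pow_one, Pi.sub_apply]
    have m := hw₁.monotone hw₂
    have c1 := frictionCap_le (q := q₁ τ) hl hg hμ (hA τ hm) (hP₁ τ hm)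
    have c2 := frictionCap_le (q := q₂ τ) hl hg hμ (hA τ hm) (hP₂ τ hm)
    have cs := abs_frictionCap_sub_le (q₁ := q₁ τ) (q₂ := q₂ τ) hl hg hμ (hA τ hm)
      (hP₁ τ hm) (hP₂ τ hm)
    have ds := abs_pendulumDrive_sub_le hl hg (hA τ hm) (q₁ τ) (q₂ τ)
    rw [← hB] at cs ds
    rw [← hH] at c1 c2
    set D₁ := pendulumDrive l g (a τ) (q₁ τ)
    set D₂ := pendulumDrive l g (a τ) (q₂ τ)
    set C₁ := frictionCap l g μ (a τ) (q₁ τ) (p₁ τ)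
    set C₂ := frictionCap l g μ (a τ) (q₂ τ) (p₂ τ)
    set x := q₁ τ - q₂ τ
    set y := p₁ τ - p₂ τ
    have e1 : x * y ≤ |x| * |y| := by rw [← abs_mul]; exact le_abs_self _
    have e2 : (D₁ - D₂) * y ≤ B * |x| * |y| := by
      refine (le_abs_self _).trans ?_
      rw [abs_mul]; gcongr
    have e3 : |C₁ - C₂| * |y| ≤ (μ * B * |x| + 2 * μ * P * |y|) * |y| := by gcongr
    have e4 : C₁ * ε₁ + C₂ * ε₂ ≤ H * (ε₁ + ε₂) := by
      rw [mul_add]; gcongr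
    have e5 : 2 * x * y + 2 * y * (d₁ - d₂) ≤
        2 * (1 + (1 + μ) * B) * (|x| * |y|) + 4 * μ * P * |y| ^ 2 + 2 * (H * (ε₁ + ε₂)) := by
      nlinarith
    have e6 : 2 * (|x| * |y|) ≤ x ^ 2 + y ^ 2 := by
      rw [← sq_abs x, ← sq_abs y]; nlinarith [sq_nonneg (|x| - |y|)]
    have e7 : 0 ≤ 1 + (1 + μ) * B := by positivity
    have e8 : 4 * μ * P * |y| ^ 2 ≤ 4 * μ * P * (x ^ 2 + y ^ 2) := by
      rw [sq_abs]; gcongr; nlinarith [sq_nonneg x]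
    have e9 : 1 * (2 * (H * (ε₁ + ε₂))) ≤ K * (2 * (H * (ε₁ + ε₂))) := by
      gcongr
      rw [hK]
      have : 0 ≤ (1 + μ) * B + 4 * μ * P := by positivity
      linarith
    have e10 := mul_le_mul_of_nonneg_left e6 e7
    have e11 : K * (x ^ 2 + y ^ 2 + 2 * H * (ε₁ + ε₂)) = (1 + (1 + μ) * B) * (x ^ 2 + y ^ 2)
        + 4 * μ * P * (x ^ 2 + y ^ 2) + K * (2 * (H * (ε₁ + ε₂))) := by rw [hK]; ring
    rw [e11]
    linarith) ht
  have : 0 ≤ 2 * H * (ε₁ + ε₂) := by positivity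
  linarith

/-! ### Existence for the regularized equations -/

/-- The nearest point to `x` in `[-M, M]`. -/
def symmClamp (M x : ℝ) : ℝ := max (-M) (min M x)

theorem abs_symmClamp_le {M : ℝ} (hM : 0 ≤ M) (x : ℝ) : |symmClamp M x| ≤ M := by
  unfold symmClamp
  rw [abs_le]
  exact ⟨le_max_left _ _, max_le (by linarith) (min_le_left _ _)⟩

theorem symmClamp_eq {M x : ℝ} (h : |x| ≤ M) : symmClamp M x = x := by
  rw [abs_le] at h
  unfold symmClamp
  rw [min_eq_right h.2, max_eq_right h.1]

theorem abs_symmClamp_sub_le (M x y : ℝ) : |symmClamp M x - symmClamp M y| ≤ |x - y| := by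
  unfold symmClamp
  refine (abs_max_sub_max_le_max _ _ _ _).trans ?_
  rw [sub_self, abs_zero, max_eq_right (abs_nonneg _)]
  refine (abs_min_sub_min_le_max _ _ _ _).trans ?_
  rw [sub_self, abs_zero, max_eq_right (abs_nonneg _)]

theorem symmClamp_div_mul_nonneg {ε : ℝ} (hε : 0 < ε) (p : ℝ) : 0 ≤ symmClamp 1 (p / ε) * p := by
  unfold symmClamp
  rcases le_total 0 p with h | h
  · have : 0 ≤ p / ε := by positivity
    exact mul_nonneg (le_max_of_le_right (le_min zero_le_one this)) h
  · have : p / ε ≤ 0 := div_nonpos_of_nonpos_of_nonneg h hε.le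
    exact mul_nonneg_of_nonpos_of_nonpos (max_le (by norm_num) ((min_le_right _ _).trans this)) h

theorem abs_sub_le_symmClamp_div_mul {ε : ℝ} (hε : 0 < ε) (p : ℝ) :
    |p| - ε ≤ symmClamp 1 (p / ε) * p := by
  rcases le_total (|p|) ε with h | h
  · exact (sub_nonpos.2 h).trans (symmClamp_div_mul_nonneg hε p)
  · unfold symmClamp
    rcases le_total 0 p with h0 | h0
    · rw [abs_of_nonneg h0] at h ⊢
      rw [min_eq_left ((one_le_div hε).2 h), max_eq_right (by norm_num)]
      linarith
    · rw [abs_of_nonpos h0] at h ⊢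
      have : p / ε ≤ -1 := by rw [div_le_iff₀ hε]; linarith
      rw [min_eq_right (by linarith), max_eq_left this]
      linarith

/-- The equations of motion with the sign of the velocity replaced by a continuous function that
agrees with it outside of `[-ε, ε]`, and with the velocity cut off at `P`. This makes the vector
field bounded and Lipschitz. -/
noncomputable def regularizedRHS (l g μ ε P α : ℝ) (x : ℝ × ℝ) : ℝ × ℝ :=
  (symmClamp P x.2, pendulumDrive l g α x.1
    - frictionCap l g μ α x.1 (symmClamp P x.2) * symmClamp 1 (x.2 / ε))

theorem norm_regularizedRHS_le {l g μ ε P α A : ℝ} (hl : 0 < l) (hg : 0 < g) (hμ : 0 < μ)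
    (hP : 0 ≤ P) (hα : |α| ≤ A) (x : ℝ × ℝ) :
    ‖regularizedRHS l g μ ε P α x‖ ≤ P + (A + g) / l + μ / l * (A + l * P ^ 2 + g) := by
  have hA : 0 ≤ A := (abs_nonneg _).trans hα
  have h1 := abs_symmClamp_le hP x.2
  have h2 := abs_pendulumDrive_le hl hg hα x.1
  have h3 := frictionCap_le (q := x.1) hl hg hμ hα h1
  have h4 := abs_symmClamp_le zero_le_one (x.2 / ε)
  have h5 := frictionCap_nonneg (g := g) hl hμ α x.1 (symmClamp P x.2)
  have h6 : |frictionCap l g μ α x.1 (symmClamp P x.2) * symmClamp 1 (x.2 / ε)| ≤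
      μ / l * (A + l * P ^ 2 + g) := by
    rw [abs_mul, abs_of_nonneg h5]
    calc _ ≤ frictionCap l g μ α x.1 (symmClamp P x.2) * 1 := by gcongr
      _ ≤ _ := by rw [mul_one]; exact h3
  have h7 : 0 ≤ (A + g) / l := by positivity
  have h8 : 0 ≤ μ / l * (A + l * P ^ 2 + g) := by positivity
  rw [Prod.norm_def]
  apply max_le
  · rw [Real.norm_eq_abs]
    change |symmClamp P x.2| ≤ _
    linarith
  · rw [Real.norm_eq_abs]
    refine (abs_sub _ _).trans ?_
    linarith

theorem exists_lipschitzWith_regularizedRHS {l g μ ε P A : ℝ} (hl : 0 < l) (hg : 0 < g)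
    (hμ : 0 < μ) (hε : 0 < ε) (hP : 0 ≤ P) (hA : 0 ≤ A) :
    ∃ K, ∀ α, |α| ≤ A → LipschitzWith K (regularizedRHS l g μ ε P α) := by
  set B := (A + g) / l with hB
  set H := μ / l * (A + l * P ^ 2 + g) with hH
  have hB0 : 0 ≤ B := by positivity
  have hH0 : 0 ≤ H := by positivity
  have hK : 0 ≤ 1 + B + μ * B + 2 * μ * P + H / ε := by positivity
  refine ⟨⟨_, hK⟩, fun α hα => LipschitzWith.of_dist_le_mul fun x y => ?_⟩
  change _ ≤ (1 + B + μ * B + 2 * μ * P + H / ε) * dist x y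
  have hq : |x.1 - y.1| ≤ dist x y := by
    rw [← Real.dist_eq, Prod.dist_eq]; exact le_max_left _ _
  have hp : |x.2 - y.2| ≤ dist x y := by
    rw [← Real.dist_eq, Prod.dist_eq]; exact le_max_right _ _
  have hc := abs_symmClamp_sub_le P x.2 y.2
  have hs : |symmClamp 1 (x.2 / ε) - symmClamp 1 (y.2 / ε)| ≤ dist x y / ε := by
    refine (abs_symmClamp_sub_le _ _ _).trans ?_
    rw [← sub_div, abs_div, abs_of_pos hε]
    gcongr
  have hx := abs_symmClamp_le hP x.2
  have hy := abs_symmClamp_le hP y.2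
  have h1 := abs_pendulumDrive_sub_le hl hg hα x.1 y.1
  have h2 := abs_frictionCap_sub_le (q₁ := x.1) (q₂ := y.1) hl hg hμ hα hx hy
  have h3 := frictionCap_le (q := x.1) hl hg hμ hα hx
  have h4 := abs_symmClamp_le zero_le_one (y.2 / ε)
  have h5 := frictionCap_nonneg (g := g) hl hμ α x.1 (symmClamp P x.2)
  rw [← hB] at h1 h2
  rw [← hH] at h3
  have hd : 0 ≤ dist x y := dist_nonneg
  rw [Prod.dist_eq]
  apply max_le
  · rw [Real.dist_eq]
    change |symmClamp P x.2 - symmClamp P y.2| ≤ _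
    have : 1 * dist x y ≤ (1 + B + μ * B + 2 * μ * P + H / ε) * dist x y := by
      gcongr
      have : 0 ≤ B + μ * B + 2 * μ * P + H / ε := by positivity
      linarith
    linarith
  · rw [Real.dist_eq]
    unfold regularizedRHS
    simp only
    set D₁ := pendulumDrive l g α x.1
    set D₂ := pendulumDrive l g α y.1
    set C₁ := frictionCap l g μ α x.1 (symmClamp P x.2)
    set C₂ := frictionCap l g μ α y.1 (symmClamp P y.2)
    set s₁ := symmClamp 1 (x.2 / ε)
    set s₂ := symmClamp 1 (y.2 / ε)
    have e : D₁ - C₁ * s₁ - (D₂ - C₂ * s₂) = (D₁ - D₂) - (C₁ * (s₁ - s₂) + (C₁ - C₂) * s₂) := by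
      ring
    have e1 : |C₁ * (s₁ - s₂)| ≤ H * (dist x y / ε) := by
      rw [abs_mul, abs_of_nonneg h5]; gcongr
    have e2 : |(C₁ - C₂) * s₂| ≤ (μ * B * dist x y + 2 * μ * P * dist x y) * 1 := by
      rw [abs_mul]
      refine mul_le_mul (h2.trans ?_) h4 (abs_nonneg _) (by positivity)
      have := hc.trans hp
      gcongr
    have e3 : |D₁ - D₂| ≤ B * dist x y := h1.trans (by gcongr)
    rw [e]
    refine (abs_sub _ _).trans ?_
    have := abs_add_le (C₁ * (s₁ - s₂)) ((C₁ - C₂) * s₂)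
    have e4 : (1 + B + μ * B + 2 * μ * P + H / ε) * dist x y = dist x y + B * dist x y +
      (μ * B * dist x y + 2 * μ * P * dist x y) * 1 + H * (dist x y / ε) := by ring
    rw [e4]
    linarith

theorem absolutelyContinuousOnInterval_of_hasDerivWithinAt {E : Type*} [NormedAddCommGroup E]
    [NormedSpace ℝ E] {x x' : ℝ → E} {t₀ T M : ℝ} (h0T : t₀ ≤ T) (hM : 0 ≤ M)
    (hx : ∀ t ∈ Icc t₀ T, HasDerivWithinAt x (x' t) (Icc t₀ T) t)
    (hb : ∀ t ∈ Icc t₀ T, ‖x' t‖ ≤ M) : AbsolutelyContinuousOnInterval x t₀ T := by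
  apply LipschitzOnWith.absolutelyContinuousOnInterval (K := ⟨M, hM⟩)
  rw [uIcc_of_le h0T]
  exact (convex_Icc t₀ T).lipschitzOnWith_of_nnnorm_hasDerivWithin_le hx hb

theorem ae_mem_Ioo_of_mem_Icc (a b : ℝ) : ∀ᵐ t : ℝ, t ∈ Icc a b → t ∈ Ioo a b := by
  have h : ∀ c : ℝ, ∀ᵐ t : ℝ, t ≠ c := fun c => by
    simp [ae_iff]
  filter_upwards [h a, h b] with t h1 h2 ht
  exact ⟨lt_of_le_of_ne ht.1 (Ne.symm h1), lt_of_le_of_ne ht.2 h2⟩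

theorem continuous_regularizedRHS_fst {l g μ ε P : ℝ} {a : ℝ → ℝ} (ha : Continuous a)
    (x : ℝ × ℝ) : Continuous fun t => regularizedRHS l g μ ε P (a t) x := by
  unfold regularizedRHS pendulumDrive frictionCap
  fun_prop

/-- The relaxed equations have classical solutions on every interval and for all initial states. -/
theorem exists_isApproxSolution {l g μ ε A t₀ T : ℝ} {a : ℝ → ℝ} (hl : 0 < l) (hg : 0 < g)
    (hμ : 0 < μ) (hε : 0 < ε) (ha : Continuous a) (h0T : t₀ ≤ T)
    (hA : ∀ t ∈ Icc t₀ T, |a t| ≤ A) (q₀ p₀ : ℝ) :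
    ∃ q p : ℝ → ℝ, q t₀ = q₀ ∧ p t₀ = p₀ ∧ IsApproxSolution l g μ ε a t₀ T q p ∧
      ∀ t ∈ Icc t₀ T, HasDerivWithinAt q (p t) (Icc t₀ T) t ∧
        ∃ d, HasDerivWithinAt p d (Icc t₀ T) t ∧ FrictionLaw l g μ ε (a t) (q t) (p t) d := by
  have hA0 : 0 ≤ A := (abs_nonneg _).trans (hA t₀ ⟨le_rfl, h0T⟩)
  set B := (A + g) / l with hB
  set P := speedBound |p₀| B (T - t₀) with hPdef
  have hP : 0 ≤ P := (speedBound_pos _ _ _).le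
  obtain ⟨K, hK⟩ := exists_lipschitzWith_regularizedRHS (P := P) hl hg hμ hε hP hA0
  have hL : 0 ≤ P + B + μ / l * (A + l * P ^ 2 + g) := by positivity
  have hτ : 0 ≤ T - t₀ := sub_nonneg.2 h0T
  -- the vector field is bounded, so a ball of radius `L * (T - t₀)` contains the whole motion
  have hPL : IsPicardLindelof (fun t x => regularizedRHS l g μ ε P (a t) x)
      (⟨t₀, le_rfl, h0T⟩ : Icc t₀ T) (q₀, p₀)
      (⟨_, mul_nonneg hL hτ⟩) 0 ⟨_, hL⟩ K := by
    refine ⟨fun t ht => (hK _ (hA t ht)).lipschitzOnWith,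
      fun x _ => (continuous_regularizedRHS_fst ha x).continuousOn,
      fun t ht x _ => norm_regularizedRHS_le hl hg hμ hP (hA t ht) x, ?_⟩
    simp only [max_eq_left hτ, sub_self, NNReal.coe_zero, sub_zero]
    rfl
  obtain ⟨x, hx0, hx⟩ := hPL.exists_eq_forall_mem_Icc_hasDerivWithinAt₀
  change x t₀ = _ at hx0
  have hq : ∀ t ∈ Icc t₀ T, HasDerivWithinAt (fun t => (x t).1) (symmClamp P (x t).2)
      (Icc t₀ T) t := fun t ht => (hx t ht).fst
  have hp : ∀ t ∈ Icc t₀ T, HasDerivWithinAt (fun t => (x t).2)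
      (regularizedRHS l g μ ε P (a t) (x t)).2 (Icc t₀ T) t := fun t ht => (hx t ht).snd
  have hbd : ∀ t ∈ Icc t₀ T, ‖regularizedRHS l g μ ε P (a t) (x t)‖ ≤
      P + B + μ / l * (A + l * P ^ 2 + g) :=
    fun t ht => norm_regularizedRHS_le hl hg hμ hP (hA t ht) (x t)
  have hqAC : AbsolutelyContinuousOnInterval (fun t => (x t).1) t₀ T :=
    absolutelyContinuousOnInterval_of_hasDerivWithinAt h0T hL hq
      fun t ht => (norm_fst_le (regularizedRHS l g μ ε P (a t) (x t))).trans (hbd t ht)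
  have hpAC : AbsolutelyContinuousOnInterval (fun t => (x t).2) t₀ T :=
    absolutelyContinuousOnInterval_of_hasDerivWithinAt h0T hL hp
      fun t ht => (norm_snd_le _).trans (hbd t ht)
  have hat : ∀ᵐ t : ℝ, t ∈ Icc t₀ T → HasDerivAt (fun t => (x t).2)
      (regularizedRHS l g μ ε P (a t) (x t)).2 t := by
    filter_upwards [ae_mem_Ioo_of_mem_Icc t₀ T] with t ht hm
    exact (hp t hm).hasDerivAt (Icc_mem_nhds (ht hm).1 (ht hm).2)
  have hbound : ∀ t ∈ Icc t₀ T, |(x t).2| ≤ P := by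
    intro t ht
    refine abs_le_speedBound hpAC ?_ (by rw [hx0]) ht
    filter_upwards [hat] with τ h hm
    refine ⟨_, h hm, ?_⟩
    have h1 : pendulumDrive l g (a τ) (x τ).1 * (x τ).2 ≤ B * |(x τ).2| := by
      refine (le_abs_self _).trans ?_
      rw [abs_mul]
      gcongr
      exact abs_pendulumDrive_le hl hg (hA τ hm) _
    have h2 := mul_nonneg (frictionCap_nonneg (g := g) hl hμ (a τ) (x τ).1 (symmClamp P (x τ).2))
      (symmClamp_div_mul_nonneg hε (x τ).2)
    unfold regularizedRHS
    simp only
    linarith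
  have hlaw : ∀ t ∈ Icc t₀ T, FrictionLaw l g μ ε (a t) (x t).1 (x t).2
      (regularizedRHS l g μ ε P (a t) (x t)).2 := by
    intro t ht
    have hc := frictionCap_nonneg (g := g) hl hμ (a t) (x t).1 (x t).2
    have hs : pendulumDrive l g (a t) (x t).1 - (regularizedRHS l g μ ε P (a t) (x t)).2 =
        frictionCap l g μ (a t) (x t).1 (x t).2 * symmClamp 1 ((x t).2 / ε) := by
      unfold regularizedRHS
      rw [symmClamp_eq (hbound t ht)]
      ring
    refine ⟨?_, ?_, ?_⟩
    · rw [hs, abs_mul, abs_of_nonneg hc]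
      exact mul_le_of_le_one_right hc (abs_symmClamp_le zero_le_one _)
    · rw [hs, mul_assoc]
      exact mul_nonneg hc (symmClamp_div_mul_nonneg hε _)
    · rw [hs, mul_assoc]
      exact mul_le_mul_of_nonneg_left (abs_sub_le_symmClamp_div_mul hε _) hc
  have hq' : ∀ t ∈ Icc t₀ T, HasDerivWithinAt (fun t => (x t).1) (x t).2 (Icc t₀ T) t := by
    intro t ht
    have := hq t ht
    rwa [symmClamp_eq (hbound t ht)] at this
  refine ⟨fun t => (x t).1, fun t => (x t).2, by simp [hx0], by simp [hx0], ⟨hqAC, hpAC, ?_⟩,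
    fun t ht => ⟨hq' t ht, _, hp t ht, hlaw t ht⟩⟩
  filter_upwards [hat, ae_mem_Ioo_of_mem_Icc t₀ T] with t h1 h2 hm
  exact ⟨(hq' t hm).hasDerivAt (Icc_mem_nhds (h2 hm).1 (h2 hm).2), _, h1 hm, hlaw t hm⟩

/-! ### Passage to the limit in the regularized equations -/

/-- An upper bound for the derivatives of `f n`, in the limit `n → ∞` and near `t`, bounds the
derivative at `t` of the pointwise limit. -/
theorem HasDerivAt.le_of_tendsto_of_le {f : ℕ → ℝ → ℝ} {F : ℝ → ℝ} {G : ℕ × ℝ → ℝ} {t d c : ℝ}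
    (hF : HasDerivAt F d t) (hlim : ∀ᶠ τ in 𝓝 t, Tendsto (fun n => f n τ) atTop (𝓝 (F τ)))
    (hG : Tendsto G (atTop ×ˢ 𝓝 t) (𝓝 c))
    (hd : ∀ᶠ z in (atTop : Filter ℕ) ×ˢ 𝓝 t, ∃ d', HasDerivAt (f z.1) d' z.2 ∧ d' ≤ G z) :
    d ≤ c := by
  refine le_of_forall_gt_imp_ge_of_dense fun c' hc' => ?_
  have h1 : ∀ᶠ z in (atTop : Filter ℕ) ×ˢ 𝓝 t, ∃ d', HasDerivAt (f z.1) d' z.2 ∧ d' ≤ c' := by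
    filter_upwards [hd, hG.eventually (gt_mem_nhds hc')] with z ⟨d', h, h'⟩ hz
    exact ⟨d', h, h'.trans hz.le⟩
  obtain ⟨pa, hpa, pb, hpb, hab⟩ := eventually_prod_iff.1 h1
  obtain ⟨δ, hδ, hball⟩ := Metric.eventually_nhds_iff_ball.1 (hpb.and hlim)
  have h2 : ∀ τ ∈ Ioo t (t + δ), F τ - F t ≤ c' * (τ - t) := by
    intro τ hτ
    have hmem : ∀ s ∈ Icc t τ, s ∈ Metric.ball t δ := fun s hs => by
      rw [Real.ball_eq_Ioo]
      exact ⟨by linarith [hs.1], by linarith [hs.2, hτ.2]⟩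
    have l1 := (hball τ (hmem τ ⟨hτ.1.le, le_rfl⟩)).2
    have l2 := (hball t (hmem t ⟨le_rfl, hτ.1.le⟩)).2
    refine le_of_tendsto (l1.sub l2) ?_
    filter_upwards [hpa] with n hn
    have hder : ∀ s ∈ Icc t τ, ∃ d', HasDerivAt (f n) d' s ∧ d' ≤ c' := fun s hs =>
      hab hn (hball s (hmem s hs)).1
    refine (convex_Icc t τ).image_sub_le_mul_sub_of_deriv_le (fun s hs => ?_) (fun s hs => ?_)
      (fun s hs => ?_) t ⟨le_rfl, hτ.1.le⟩ τ ⟨hτ.1.le, le_rfl⟩ hτ.1.le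
    · obtain ⟨d', hd', -⟩ := hder s hs
      exact hd'.continuousAt.continuousWithinAt
    · obtain ⟨d', hd', -⟩ := hder s (interior_subset hs)
      exact hd'.differentiableAt.differentiableWithinAt
    · obtain ⟨d', hd', hle⟩ := hder s (interior_subset hs)
      rw [hd'.deriv]; exact hle
  have h3 : Tendsto (slope F t) (𝓝[>] t) (𝓝 d) :=
    (hasDerivAt_iff_tendsto_slope.1 hF).mono_left
      (nhdsWithin_mono _ fun x hx => ne_of_gt hx)
  refine le_of_tendsto h3 ?_
  filter_upwards [Ioo_mem_nhdsGT (show t < t + δ by linarith)] with τ hτ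
  rw [slope_def_field, div_le_iff₀ (by linarith [hτ.1])]
  exact h2 τ hτ

theorem tendsto_prod_nhds_of_dist_le {f : ℕ → ℝ → ℝ} {F : ℝ → ℝ} {b : ℕ → ℝ} {s : Set ℝ} {t : ℝ}
    (hs : s ∈ 𝓝 t) (hb : Tendsto b atTop (𝓝 0)) (h : ∀ n, ∀ τ ∈ s, dist (f n τ) (F τ) ≤ b n)
    (hF : ContinuousAt F t) :
    Tendsto (fun z : ℕ × ℝ => f z.1 z.2) (atTop ×ˢ 𝓝 t) (𝓝 (F t)) := by
  rw [tendsto_iff_dist_tendsto_zero]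
  have h1 : Tendsto (fun z : ℕ × ℝ => b z.1 + dist (F z.2) (F t)) (atTop ×ˢ 𝓝 t) (𝓝 (0 + 0)) :=
    (hb.comp tendsto_fst).add ((tendsto_iff_dist_tendsto_zero.1 hF).comp tendsto_snd)
  rw [add_zero] at h1
  refine squeeze_zero' (Eventually.of_forall fun _ => dist_nonneg) ?_ h1
  filter_upwards [tendsto_snd.eventually hs] with z hz
  exact (dist_triangle _ (F z.2) _).trans (by gcongr; exact h _ _ hz)

theorem continuous_pendulumDrive (l g : ℝ) :
    Continuous fun x : ℝ × ℝ => pendulumDrive l g x.1 x.2 := by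
  unfold pendulumDrive; fun_prop

theorem continuous_frictionCap (l g μ : ℝ) :
    Continuous fun x : ℝ × ℝ × ℝ => frictionCap l g μ x.1 x.2.1 x.2.2 := by
  unfold frictionCap; fun_prop

theorem FrictionLaw.abs_deriv_le {l g μ α A P ε q p d : ℝ} (hl : 0 < l) (hg : 0 < g)
    (hμ : 0 < μ) (hα : |α| ≤ A) (hp : |p| ≤ P) (h : FrictionLaw l g μ ε α q p d) :
    |d| ≤ (A + g) / l + μ / l * (A + l * P ^ 2 + g) := by
  have h1 := abs_pendulumDrive_le hl hg hα q
  have h2 := h.abs_le.trans (frictionCap_le hl hg hμ hα hp)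
  have h3 := abs_sub (pendulumDrive l g α q) (pendulumDrive l g α q - d)
  rw [sub_sub_cancel] at h3
  linarith

/-- For `ε = 0` the sign condition follows from the other two. -/
theorem frictionLaw_zero_iff {l g μ α q p d : ℝ} (hl : 0 < l) (hμ : 0 < μ) :
    FrictionLaw l g μ 0 α q p d ↔
      |pendulumDrive l g α q - d| ≤ frictionCap l g μ α q p ∧
        frictionCap l g μ α q p * |p| ≤ (pendulumDrive l g α q - d) * p := by
  constructor
  · intro h
    exact ⟨h.abs_le, by simpa using h.cap_mul_le⟩
  · rintro ⟨h1, h2⟩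
    exact ⟨h1, (mul_nonneg (frictionCap_nonneg hl hμ _ _ _) (abs_nonneg _)).trans h2,
      by simpa using h2⟩

/-- Exact motions exist on every bounded interval, as limits of regularized ones. -/
theorem exists_isSolution {l g μ t₀ T : ℝ} {a : ℝ → ℝ} (hl : 0 < l) (hg : 0 < g)
    (hμ : 0 < μ) (ha : Continuous a) (h0T : t₀ ≤ T) (q₀ p₀ : ℝ) :
    ∃ q p : ℝ → ℝ, q t₀ = q₀ ∧ p t₀ = p₀ ∧ IsApproxSolution l g μ 0 a t₀ T q p := by
  obtain ⟨A, hA⟩ : ∃ A, ∀ t ∈ Icc t₀ T, |a t| ≤ A :=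
    isCompact_Icc.exists_bound_of_continuousOn ha.continuousOn
  have hA0 : 0 ≤ A := (abs_nonneg _).trans (hA t₀ ⟨le_rfl, h0T⟩)
  set ε : ℕ → ℝ := fun n => 1 / ((n : ℝ) + 1) with hεdef
  have hε : ∀ n, 0 < ε n := fun n => by positivity
  have hεanti : ∀ {n m}, n ≤ m → ε m ≤ ε n := fun {n m} h => by
    simp only [hεdef]; gcongr
  have hε0 : Tendsto ε atTop (𝓝 0) := tendsto_one_div_add_atTop_nhds_zero_nat
  choose q p hq0 hp0 hsol hder using fun n =>
    exists_isApproxSolution (q₀ := q₀) (p₀ := p₀) hl hg hμ (hε n) ha h0T hA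
  set B := (A + g) / l with hB
  set P := speedBound |p₀| B (T - t₀) with hP
  set H := μ / l * (A + l * P ^ 2 + g) with hH
  set K := 1 + (1 + μ) * B + 4 * μ * P with hK
  have hP0 : 0 ≤ P := (speedBound_pos _ _ _).le
  have hB0 : 0 ≤ B := by positivity
  have hH0 : 0 ≤ H := by positivity
  have hK0 : 0 ≤ K := by positivity
  have hpP : ∀ n, ∀ t ∈ Icc t₀ T, |p n t| ≤ P := fun n t ht =>
    (hsol n).abs_snd_le hl hg hA (by rw [hp0]) ht
  set C := Real.exp (K * (T - t₀)) * (2 * H) with hC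
  have hC0 : 0 ≤ C := by positivity
  set b : ℕ → ℝ := fun n => √(C * (2 * ε n)) with hb
  have hb0 : Tendsto b atTop (𝓝 0) := by
    have : Tendsto (fun n => C * (2 * ε n)) atTop (𝓝 (C * (2 * 0))) :=
      (hε0.const_mul 2).const_mul C
    rw [mul_zero, mul_zero] at this
    simpa using this.sqrt
  have hcl : ∀ t ∈ Icc t₀ T, ∀ n m N, N ≤ n → N ≤ m →
      (q n t - q m t) ^ 2 + (p n t - p m t) ^ 2 ≤ C * (2 * ε N) := by
    intro t ht n m N hn hm
    have h1 := (hsol n).dist_sq_le hl hg hμ (hε n).le (hε m).le hA (hsol m) (hpP n) (hpP m) ht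
    rw [hq0, hq0, hp0, hp0, ← hB, ← hH, ← hK] at h1
    have h2 : Real.exp (K * (t - t₀)) ≤ Real.exp (K * (T - t₀)) := by
      gcongr; exact ht.2
    have h3 : ε n + ε m ≤ 2 * ε N := by linarith [hεanti hn, hεanti hm]
    have h4 : 0 ≤ ε n + ε m := (add_pos (hε n) (hε m)).le
    calc _ ≤ _ := h1
      _ = Real.exp (K * (t - t₀)) * (2 * H) * (ε n + ε m) := by ring
      _ ≤ Real.exp (K * (T - t₀)) * (2 * H) * (2 * ε N) := by gcongr
  have hdq : ∀ t ∈ Icc t₀ T, ∀ n m N, N ≤ n → N ≤ m → dist (q n t) (q m t) ≤ b N := by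
    intro t ht n m N hn hm
    have := hcl t ht n m N hn hm
    rw [Real.dist_eq]
    exact Real.abs_le_sqrt (by nlinarith [sq_nonneg (p n t - p m t)])
  have hdp : ∀ t ∈ Icc t₀ T, ∀ n m N, N ≤ n → N ≤ m → dist (p n t) (p m t) ≤ b N := by
    intro t ht n m N hn hm
    have := hcl t ht n m N hn hm
    rw [Real.dist_eq]
    exact Real.abs_le_sqrt (by nlinarith [sq_nonneg (q n t - q m t)])
  choose! Q hQ using fun t (ht : t ∈ Icc t₀ T) =>
    cauchySeq_tendsto_of_complete (cauchySeq_of_le_tendsto_0 b (hdq t ht) hb0)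
  choose! V hV using fun t (ht : t ∈ Icc t₀ T) =>
    cauchySeq_tendsto_of_complete (cauchySeq_of_le_tendsto_0 b (hdp t ht) hb0)
  have hqQ : ∀ n, ∀ t ∈ Icc t₀ T, dist (q n t) (Q t) ≤ b n := fun n t ht =>
    le_of_tendsto (tendsto_const_nhds.dist (hQ t ht))
      (eventually_atTop.2 ⟨n, fun m hm => hdq t ht n m n le_rfl hm⟩)
  have hpV : ∀ n, ∀ t ∈ Icc t₀ T, dist (p n t) (V t) ≤ b n := fun n t ht =>
    le_of_tendsto (tendsto_const_nhds.dist (hV t ht))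
      (eventually_atTop.2 ⟨n, fun m hm => hdp t ht n m n le_rfl hm⟩)
  choose! d hd hlaw using fun n t (ht : t ∈ Icc t₀ T) => (hder n t ht).2
  have hdM : ∀ n, ∀ t ∈ Icc t₀ T, |d n t| ≤ B + H := fun n t ht =>
    (hlaw n t ht).abs_deriv_le hl hg hμ (hA t ht) (hpP n t ht)
  have hM0 : 0 ≤ B + H := by positivity
  have hmemt : t₀ ∈ Icc t₀ T := ⟨le_rfl, h0T⟩
  have hlipQ : LipschitzOnWith ⟨P, hP0⟩ Q (uIcc t₀ T) := by
    rw [uIcc_of_le h0T]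
    refine LipschitzOnWith.of_dist_le_mul fun x hx y hy => ?_
    refine le_of_tendsto ((hQ x hx).dist (hQ y hy)) (Eventually.of_forall fun n => ?_)
    exact ((convex_Icc t₀ T).lipschitzOnWith_of_nnnorm_hasDerivWithin_le (C := ⟨P, hP0⟩)
      (fun t ht => (hder n t ht).1) (fun t ht => hpP n t ht)).dist_le_mul x hx y hy
  have hlipV : LipschitzOnWith ⟨B + H, hM0⟩ V (uIcc t₀ T) := by
    rw [uIcc_of_le h0T]
    refine LipschitzOnWith.of_dist_le_mul fun x hx y hy => ?_
    refine le_of_tendsto ((hV x hx).dist (hV y hy)) (Eventually.of_forall fun n => ?_)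
    exact ((convex_Icc t₀ T).lipschitzOnWith_of_nnnorm_hasDerivWithin_le (C := ⟨B + H, hM0⟩)
      (hd n) (fun t ht => hdM n t ht)).dist_le_mul x hx y hy
  have hACQ := hlipQ.absolutelyContinuousOnInterval
  have hACV := hlipV.absolutelyContinuousOnInterval
  refine ⟨Q, V, tendsto_nhds_unique (hQ t₀ hmemt) (by simp [hq0]),
    tendsto_nhds_unique (hV t₀ hmemt) (by simp [hp0]), hACQ, hACV, ?_⟩
  have hu := hACQ.ae_differentiableAt
  have hv := hACV.ae_differentiableAt
  rw [uIcc_of_le h0T] at hu hv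
  filter_upwards [ae_mem_Ioo_of_mem_Icc t₀ T, hu, hv] with t hIoo hu hv ht
  have hIcc : Icc t₀ T ∈ 𝓝 t := Icc_mem_nhds (hIoo ht).1 (hIoo ht).2
  have hQd := (hu ht).hasDerivAt
  have hVd := (hv ht).hasDerivAt
  have tq := tendsto_prod_nhds_of_dist_le hIcc hb0 hqQ hQd.continuousAt
  have tp := tendsto_prod_nhds_of_dist_le hIcc hb0 hpV hVd.continuousAt
  have ta : Tendsto (fun z : ℕ × ℝ => a z.2) (atTop ×ˢ 𝓝 t) (𝓝 (a t)) :=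
    (ha.tendsto t).comp tendsto_snd
  have tD := ((continuous_pendulumDrive l g).tendsto (a t, Q t)).comp (ta.prodMk_nhds tq)
  have tC := ((continuous_frictionCap l g μ).tendsto (a t, Q t, V t)).comp
    (ta.prodMk_nhds (tq.prodMk_nhds tp))
  have tε : Tendsto (fun z : ℕ × ℝ => ε z.1) (atTop ×ˢ 𝓝 t) (𝓝 0) := hε0.comp tendsto_fst
  have hIoo' : ∀ᶠ z in (atTop : Filter ℕ) ×ˢ 𝓝 t, z.2 ∈ Ioo t₀ T :=
    tendsto_snd.eventually (Ioo_mem_nhds (hIoo ht).1 (hIoo ht).2)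
  have hqd : ∀ n, ∀ τ ∈ Ioo t₀ T, HasDerivAt (q n) (p n τ) τ := fun n τ hτ =>
    (hder n τ (Ioo_subset_Icc_self hτ)).1.hasDerivAt (Icc_mem_nhds hτ.1 hτ.2)
  have hpd : ∀ n, ∀ τ ∈ Ioo t₀ T, HasDerivAt (p n) (d n τ) τ := fun n τ hτ =>
    (hd n τ (Ioo_subset_Icc_self hτ)).hasDerivAt (Icc_mem_nhds hτ.1 hτ.2)
  have hlq : ∀ᶠ τ in 𝓝 t, Tendsto (fun n => q n τ) atTop (𝓝 (Q τ)) := by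
    filter_upwards [hIcc] with τ hτ using hQ τ hτ
  have hlp : ∀ᶠ τ in 𝓝 t, Tendsto (fun n => p n τ) atTop (𝓝 (V τ)) := by
    filter_upwards [hIcc] with τ hτ using hV τ hτ
  have hQV : deriv Q t = V t := by
    apply le_antisymm
    · refine hQd.le_of_tendsto_of_le hlq tp ?_
      filter_upwards [hIoo'] with z hz using ⟨_, hqd _ _ hz, le_rfl⟩
    · refine neg_le_neg_iff.1 (hQd.neg.le_of_tendsto_of_le (f := fun n => -q n) ?_ tp.neg ?_)
      · filter_upwards [hlq] with τ hτ using hτ.neg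
      · filter_upwards [hIoo'] with z hz using ⟨_, (hqd _ _ hz).neg, le_rfl⟩
  refine ⟨hQV ▸ hQd, _, hVd, (frictionLaw_zero_iff hl hμ).2 ⟨?_, ?_⟩⟩
  · rw [abs_le]
    constructor
    · have : deriv V t ≤ pendulumDrive l g (a t) (Q t) + frictionCap l g μ (a t) (Q t) (V t) := by
        refine hVd.le_of_tendsto_of_le hlp (tD.add tC) ?_
        filter_upwards [hIoo'] with z hz
        refine ⟨_, hpd _ _ hz, ?_⟩
        have := (abs_le.1 (hlaw z.1 z.2 (Ioo_subset_Icc_self hz)).abs_le).1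
        simp only [Function.comp_apply]
        linarith
      linarith
    · have : -deriv V t ≤ -pendulumDrive l g (a t) (Q t)
          + frictionCap l g μ (a t) (Q t) (V t) := by
        refine hVd.neg.le_of_tendsto_of_le (f := fun n => -p n) ?_ (tD.neg.add tC) ?_
        · filter_upwards [hlp] with τ hτ using hτ.neg
        filter_upwards [hIoo'] with z hz
        refine ⟨_, (hpd _ _ hz).neg, ?_⟩
        have := (abs_le.1 (hlaw z.1 z.2 (Ioo_subset_Icc_self hz)).abs_le).2
        simp only [Function.comp_apply]
        linarith
      linarith
  · -- the law bounds `d n * p n`, which differs little from the derivative of `V t * p n`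
    have tG := ((tD.mul tp).sub (tC.mul (tp.abs.sub tε))).add
      ((tp.const_sub (V t)).abs.mul_const (B + H))
    have := (hVd.const_mul (V t)).le_of_tendsto_of_le (f := fun n τ => V t * p n τ)
      (by filter_upwards [hlp] with τ hτ using hτ.const_mul _) tG (by
        filter_upwards [hIoo'] with z hz
        refine ⟨_, (hpd _ _ hz).const_mul _, ?_⟩
        have hz' := Ioo_subset_Icc_self hz
        have h1 := (hlaw z.1 z.2 hz').cap_mul_le
        have h2 : (V t - p z.1 z.2) * d z.1 z.2 ≤ |V t - p z.1 z.2| * (B + H) := by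
          refine (le_abs_self _).trans ?_
          rw [abs_mul]
          exact mul_le_mul_of_nonneg_left (hdM _ _ hz') (abs_nonneg _)
        simp only [Function.comp_apply]
        linarith)
    simp only [sub_self, abs_zero, zero_mul, add_zero, sub_zero] at this
    linarith

/-! ### The Filippov inclusion, uniqueness and global solutions -/

theorem pendulumRHS_eq (l g μ : ℝ) (ξ : ℝ → ℝ) (x : ℝ × ℝ) (t : ℝ) :
    pendulumRHS l g μ ξ x t = (x.2, pendulumDrive l g (deriv (deriv ξ) t) x.1
      - frictionCap l g μ (deriv (deriv ξ) t) x.1 x.2 * (x.2 / |x.2|)) := by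
  unfold pendulumRHS pendulumDrive frictionCap
  ext
  · rfl
  · simp only; ring

theorem FrictionLaw.of_ne_zero {l g μ α q p : ℝ} (hl : 0 < l) (hμ : 0 < μ) (hp : p ≠ 0) :
    FrictionLaw l g μ 0 α q p (pendulumDrive l g α q - frictionCap l g μ α q p * (p / |p|)) := by
  have hc := frictionCap_nonneg (g := g) hl hμ α q p
  have hp' : |p| ≠ 0 := abs_ne_zero.2 hp
  rw [frictionLaw_zero_iff hl hμ, sub_sub_cancel]
  constructor
  · rw [abs_mul, abs_of_nonneg hc, abs_div, abs_abs, div_self hp', mul_one]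
  · refine le_of_eq ?_
    have : p / |p| * p = |p| := by
      rw [div_mul_eq_mul_div, ← abs_mul_abs_self p, mul_div_assoc, div_self hp', mul_one]
    rw [mul_assoc, this]

/-- Each value of the differential inclusion obeys the friction law: the law holds at the points
with `p ≠ 0`, and it survives passing to limits and to closed convex hulls. -/
theorem frictionLaw_of_mem_pendulumInclusion {l g μ t : ℝ} {ξ : ℝ → ℝ} {x v : ℝ × ℝ} (hl : 0 < l)
    (hμ : 0 < μ) (hv : v ∈ pendulumInclusion l g μ ξ x t) :
    v.1 = x.2 ∧ FrictionLaw l g μ 0 (deriv (deriv ξ) t) x.1 x.2 v.2 := by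
  rw [frictionLaw_zero_iff hl hμ]
  set α := deriv (deriv ξ) t with hα
  let S : Set (ℝ × ℝ) := {v | v.1 = x.2 ∧
    |pendulumDrive l g α x.1 - v.2| ≤ frictionCap l g μ α x.1 x.2 ∧
    frictionCap l g μ α x.1 x.2 * |x.2| ≤ (pendulumDrive l g α x.1 - v.2) * x.2}
  suffices h : pendulumInclusion l g μ ξ x t ⊆ S from h hv
  refine closedConvexHull_min ?_ ?_ ?_
  · intro y hy
    obtain ⟨U, hU, hUy⟩ := mapClusterPt_iff_ultrafilter.1 hy
    have hUx : Tendsto id (U : Filter (ℝ × ℝ)) (𝓝 x) := hU.trans nhdsWithin_le_nhds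
    have hne : ∀ᶠ z in (U : Filter (ℝ × ℝ)), z.2 ≠ 0 := hU self_mem_nhdsWithin
    have t1 : Tendsto (fun z : ℝ × ℝ => z.1) (U : Filter (ℝ × ℝ)) (𝓝 x.1) :=
      (continuous_fst.tendsto x).comp hUx
    have t2 : Tendsto (fun z : ℝ × ℝ => z.2) (U : Filter (ℝ × ℝ)) (𝓝 x.2) :=
      (continuous_snd.tendsto x).comp hUx
    have tD := ((continuous_pendulumDrive l g).tendsto (α, x.1)).comp
      ((tendsto_const_nhds (f := (U : Filter (ℝ × ℝ)))).prodMk_nhds t1)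
    have tC := ((continuous_frictionCap l g μ).tendsto (α, x.1, x.2)).comp
      ((tendsto_const_nhds (f := (U : Filter (ℝ × ℝ)))).prodMk_nhds (t1.prodMk_nhds t2))
    have y1 := (continuous_fst.tendsto y).comp hUy
    have y2 := (continuous_snd.tendsto y).comp hUy
    have hlaw : ∀ᶠ z in (U : Filter (ℝ × ℝ)),
        FrictionLaw l g μ 0 α z.1 z.2 (pendulumRHS l g μ ξ z t).2 := by
      filter_upwards [hne] with z hz
      rw [pendulumRHS_eq]
      exact FrictionLaw.of_ne_zero hl hμ hz
    refine ⟨tendsto_nhds_unique y1 t2, le_of_tendsto_of_tendsto (tD.sub y2).abs tC ?_,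
      le_of_tendsto_of_tendsto (tC.mul t2.abs) ((tD.sub y2).mul t2) ?_⟩
    · filter_upwards [hlaw] with z hz using hz.abs_le
    · filter_upwards [hlaw] with z hz using ((frictionLaw_zero_iff hl hμ).1 hz).2
  · rintro v ⟨v1, v2, v3⟩ w ⟨w1, w2, w3⟩ b c hb hc hbc
    have e : ∀ D : ℝ, D - (b * v.2 + c * w.2) = b * (D - v.2) + c * (D - w.2) := fun D => by
      linear_combination (-D) * hbc
    refine ⟨?_, ?_, ?_⟩
    · simp only [Prod.fst_add, Prod.smul_fst, smul_eq_mul]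
      rw [v1, w1, ← add_mul, hbc, one_mul]
    · simp only [Prod.snd_add, Prod.smul_snd, smul_eq_mul]
      rw [e]
      refine (abs_add_le _ _).trans ?_
      rw [abs_mul, abs_mul, abs_of_nonneg hb, abs_of_nonneg hc]
      calc _ ≤ b * frictionCap l g μ α x.1 x.2 + c * frictionCap l g μ α x.1 x.2 := by gcongr
        _ = _ := by rw [← add_mul, hbc, one_mul]
    · simp only [Prod.snd_add, Prod.smul_snd, smul_eq_mul]
      rw [e]
      calc _ = b * (frictionCap l g μ α x.1 x.2 * |x.2|)
            + c * (frictionCap l g μ α x.1 x.2 * |x.2|) := by rw [← add_mul, hbc, one_mul]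
        _ ≤ b * ((pendulumDrive l g α x.1 - v.2) * x.2)
            + c * ((pendulumDrive l g α x.1 - w.2) * x.2) := by gcongr
        _ = _ := by ring
  · exact (isClosed_eq continuous_fst continuous_const).inter
      ((isClosed_le (continuous_const.sub continuous_snd).abs continuous_const).inter
        (isClosed_le continuous_const ((continuous_const.sub continuous_snd).mul
          continuous_const)))

/-- The limit of the right-hand side along states approaching `x` with the sign `s` of the velocity
is a value of the inclusion. -/
theorem mem_pendulumInclusion_of_le_nhds {l g μ t s : ℝ} {ξ : ℝ → ℝ} {x : ℝ × ℝ}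
    {F : Filter (ℝ × ℝ)} [F.NeBot] (hF : F ≤ 𝓝 x) (hs : ∀ᶠ z in F, z.2 ≠ 0 ∧ z.2 / |z.2| = s) :
    (x.2, pendulumDrive l g (deriv (deriv ξ) t) x.1
      - frictionCap l g μ (deriv (deriv ξ) t) x.1 x.2 * s) ∈ pendulumInclusion l g μ ξ x t := by
  apply subset_closedConvexHull
  have hF' : F ≤ 𝓝[{z : ℝ × ℝ | (z, t) ∉ {z : (ℝ × ℝ) × ℝ | z.1.2 = 0}}] x :=
    le_inf hF (le_principal_iff.2 (hs.mono fun z hz => hz.1))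
  refine MapClusterPt.mono (F := F) (Tendsto.mapClusterPt ?_) hF'
  have hc : Continuous fun z : ℝ × ℝ => (z.2, pendulumDrive l g (deriv (deriv ξ) t) z.1
      - frictionCap l g μ (deriv (deriv ξ) t) z.1 z.2 * s) := by
    unfold pendulumDrive frictionCap; fun_prop
  refine ((hc.tendsto x).mono_left hF).congr' ?_
  filter_upwards [hs] with z hz
  rw [pendulumRHS_eq, hz.2]

theorem map_prodMk_nhdsWithin_le_nhds {q p : ℝ} {s : Set ℝ} :
    map (fun r : ℝ => (q, r)) (𝓝[s] p) ≤ 𝓝 (q, p) :=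
  (((continuous_const.prodMk continuous_id).tendsto p).mono_left nhdsWithin_le_nhds :
    Tendsto (fun r : ℝ => (q, r)) (𝓝[s] p) (𝓝 (q, p)))

theorem mem_pendulumInclusion_of_nonneg {l g μ t q p : ℝ} {ξ : ℝ → ℝ} (hp : 0 ≤ p) :
    (p, pendulumDrive l g (deriv (deriv ξ) t) q - frictionCap l g μ (deriv (deriv ξ) t) q p) ∈
      pendulumInclusion l g μ ξ (q, p) t := by
  have := mem_pendulumInclusion_of_le_nhds (l := l) (g := g) (μ := μ) (t := t) (ξ := ξ) (s := 1)
    (map_prodMk_nhdsWithin_le_nhds (q := q) (p := p) (s := Ioi p)) (by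
      rw [eventually_map]
      filter_upwards [self_mem_nhdsWithin] with r hr
      have hr0 : 0 < r := hp.trans_lt hr
      exact ⟨hr0.ne', by rw [abs_of_pos hr0, div_self hr0.ne']⟩)
  simpa using this

theorem mem_pendulumInclusion_of_nonpos {l g μ t q p : ℝ} {ξ : ℝ → ℝ} (hp : p ≤ 0) :
    (p, pendulumDrive l g (deriv (deriv ξ) t) q + frictionCap l g μ (deriv (deriv ξ) t) q p) ∈
      pendulumInclusion l g μ ξ (q, p) t := by
  have := mem_pendulumInclusion_of_le_nhds (l := l) (g := g) (μ := μ) (t := t) (ξ := ξ) (s := -1)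
    (map_prodMk_nhdsWithin_le_nhds (q := q) (p := p) (s := Iio p)) (by
      rw [eventually_map]
      filter_upwards [self_mem_nhdsWithin] with r hr
      have hr0 : r < 0 := lt_of_lt_of_le hr hp
      exact ⟨hr0.ne, by rw [abs_of_neg hr0, div_neg, div_self hr0.ne]⟩)
  simpa using this

theorem FrictionLaw.mem_pendulumInclusion {l g μ t q p d : ℝ} {ξ : ℝ → ℝ} (hl : 0 < l)
    (hμ : 0 < μ) (h : FrictionLaw l g μ 0 (deriv (deriv ξ) t) q p d) :
    (p, d) ∈ pendulumInclusion l g μ ξ (q, p) t := by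
  obtain ⟨h1, h2⟩ := (frictionLaw_zero_iff hl hμ).1 h
  rw [_root_.abs_le] at h1
  have hc := frictionCap_nonneg (g := g) hl hμ (deriv (deriv ξ) t) q p
  have hpos := @mem_pendulumInclusion_of_nonneg l g μ t q p ξ
  have hneg := @mem_pendulumInclusion_of_nonpos l g μ t q p ξ
  set D := pendulumDrive l g (deriv (deriv ξ) t) q
  set C := frictionCap l g μ (deriv (deriv ξ) t) q p
  rcases lt_trichotomy p 0 with hp | hp | hp
  · have : d = D + C := by
      rw [abs_of_neg hp] at h2
      have : (D - d + C) * (-p) ≤ 0 := by linarith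
      have := nonpos_of_mul_nonpos_left this (by linarith)
      linarith
    rw [this]; exact hneg hp.le
  · -- at rest the friction force takes all values between the two one-sided limits
    have hconv : Convex ℝ (pendulumInclusion l g μ ξ (q, p) t) := convex_closedConvexHull
    rcases hc.eq_or_lt with h0 | h0
    · have : d = D - C := by linarith
      rw [this]; exact hpos hp.ge
    · have hm := hconv (hpos hp.ge) (hneg hp.le)
        (a := (D + C - d) / (2 * C)) (b := (d - (D - C)) / (2 * C))
        (div_nonneg (by linarith) (by linarith)) (div_nonneg (by linarith) (by linarith))
        (by field_simp; ring)
      convert! hm using 1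
      ext
      · simp [hp]
      · simp only [Prod.snd_add, Prod.smul_snd, smul_eq_mul]
        field_simp
        ring
  · have : d = D - C := by
      rw [abs_of_pos hp] at h2
      have : C ≤ D - d := le_of_mul_le_mul_right h2 hp
      linarith
    rw [this]; exact hpos hp.le

theorem AbsolutelyContinuousOnInterval.congr {X : Type*} [PseudoMetricSpace X] {f h : ℝ → X}
    {a b : ℝ} (hf : AbsolutelyContinuousOnInterval f a b) (hfh : EqOn f h (uIcc a b)) :
    AbsolutelyContinuousOnInterval h a b := by
  rw [absolutelyContinuousOnInterval_iff] at hf ⊢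
  intro ε hε
  obtain ⟨δ, hδ, H⟩ := hf ε hε
  refine ⟨δ, hδ, fun E hE hlen => ?_⟩
  refine lt_of_eq_of_lt (Finset.sum_congr rfl fun i hi => ?_) (H E hE hlen)
  have hi' := hE.1 i hi
  rw [hfh hi'.1, hfh hi'.2]

theorem AbsolutelyContinuousOnInterval.of_dist_le {X Y : Type*} [PseudoMetricSpace X]
    [PseudoMetricSpace Y] {f : ℝ → X} {h : ℝ → Y} {a b : ℝ}
    (hf : AbsolutelyContinuousOnInterval f a b)
    (hfh : ∀ s t, dist (h s) (h t) ≤ dist (f s) (f t)) :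
    AbsolutelyContinuousOnInterval h a b := by
  rw [absolutelyContinuousOnInterval_iff] at hf ⊢
  intro ε hε
  obtain ⟨δ, hδ, H⟩ := hf ε hε
  exact ⟨δ, hδ, fun E hE hlen =>
    (Finset.sum_le_sum fun i _ => hfh _ _).trans_lt (H E hE hlen)⟩

theorem AbsolutelyContinuousOnInterval.prodMk {X Y : Type*} [PseudoMetricSpace X]
    [PseudoMetricSpace Y] {f : ℝ → X} {h : ℝ → Y} {a b : ℝ}
    (hf : AbsolutelyContinuousOnInterval f a b) (hh : AbsolutelyContinuousOnInterval h a b) :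
    AbsolutelyContinuousOnInterval (fun t => (f t, h t)) a b := by
  rw [absolutelyContinuousOnInterval_iff] at hf hh ⊢
  intro ε hε
  obtain ⟨δ₁, hδ₁, H₁⟩ := hf (ε / 2) (half_pos hε)
  obtain ⟨δ₂, hδ₂, H₂⟩ := hh (ε / 2) (half_pos hε)
  refine ⟨min δ₁ δ₂, lt_min hδ₁ hδ₂, fun E hE hlen => ?_⟩
  have h1 := H₁ E hE (hlen.trans_le (min_le_left _ _))
  have h2 := H₂ E hE (hlen.trans_le (min_le_right _ _))
  refine lt_of_le_of_lt (Finset.sum_le_sum fun i _ => ?_)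
    (Finset.sum_add_distrib.trans_lt ((add_lt_add h1 h2).trans_eq (add_halves ε)))
  rw [Prod.dist_eq]
  exact max_le_add_of_nonneg dist_nonneg dist_nonneg

theorem IsApproxSolution.mono {l g μ ε t₀ T S : ℝ} {a q p : ℝ → ℝ}
    (h : IsApproxSolution l g μ ε a t₀ T q p) (h0S : t₀ ≤ S) (hST : S ≤ T) :
    IsApproxSolution l g μ ε a t₀ S q p := by
  have hsub : Icc t₀ S ⊆ Icc t₀ T := Icc_subset_Icc_right hST
  have hu : uIcc t₀ S ⊆ uIcc t₀ T := by
    rwa [uIcc_of_le h0S, uIcc_of_le (h0S.trans hST)]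
  refine ⟨h.absCont_fst.mono hu, h.absCont_snd.mono hu, ?_⟩
  filter_upwards [h.ae_law] with t ht hm using ht (hsub hm)

theorem IsApproxSolution.congr {l g μ ε t₀ T : ℝ} {a q p q' p' : ℝ → ℝ} (h0T : t₀ ≤ T)
    (h : IsApproxSolution l g μ ε a t₀ T q p) (hq : EqOn q q' (Icc t₀ T))
    (hp : EqOn p p' (Icc t₀ T)) : IsApproxSolution l g μ ε a t₀ T q' p' := by
  have hu := uIcc_of_le h0T
  refine ⟨h.absCont_fst.congr (hu ▸ hq), h.absCont_snd.congr (hu ▸ hp), ?_⟩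
  filter_upwards [h.ae_law, ae_mem_Ioo_of_mem_Icc t₀ T] with t ht hIoo hm
  obtain ⟨h1, d, h2, h3⟩ := ht hm
  have hn : Icc t₀ T ∈ 𝓝 t := Icc_mem_nhds (hIoo hm).1 (hIoo hm).2
  rw [hq hm, hp hm] at h3
  rw [hp hm] at h1
  exact ⟨h1.congr_of_eventuallyEq (hq.symm.eventuallyEq_of_mem hn), d,
    h2.congr_of_eventuallyEq (hp.symm.eventuallyEq_of_mem hn), h3⟩

/-- Uniqueness to the right. -/
theorem IsApproxSolution.eqOn {l g μ t₀ T : ℝ} {a q₁ p₁ q₂ p₂ : ℝ → ℝ} (hl : 0 < l) (hg : 0 < g)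
    (hμ : 0 < μ) (ha : Continuous a)
    (h₁ : IsApproxSolution l g μ 0 a t₀ T q₁ p₁) (h₂ : IsApproxSolution l g μ 0 a t₀ T q₂ p₂)
    (hq : q₁ t₀ = q₂ t₀) (hp : p₁ t₀ = p₂ t₀) :
    EqOn q₁ q₂ (Icc t₀ T) ∧ EqOn p₁ p₂ (Icc t₀ T) := by
  obtain ⟨A, hA⟩ : ∃ A, ∀ t ∈ Icc t₀ T, |a t| ≤ A :=
    isCompact_Icc.exists_bound_of_continuousOn ha.continuousOn
  have key : ∀ t ∈ Icc t₀ T, (q₁ t - q₂ t) ^ 2 + (p₁ t - p₂ t) ^ 2 ≤ 0 := by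
    intro t ht
    have := h₁.dist_sq_le hl hg hμ le_rfl le_rfl hA h₂
      (fun s hs => h₁.abs_snd_le hl hg hA le_rfl hs)
      (fun s hs => h₂.abs_snd_le hl hg hA (by rw [hp]) hs) ht
    simpa [hq, hp] using this
  constructor <;> intro t ht
  · have h := key t ht
    have : (q₁ t - q₂ t) ^ 2 = 0 :=
      le_antisymm (by linarith [sq_nonneg (p₁ t - p₂ t)]) (sq_nonneg _)
    exact sub_eq_zero.1 (pow_eq_zero_iff two_ne_zero |>.1 this)
  · have h := key t ht
    have : (p₁ t - p₂ t) ^ 2 = 0 :=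
      le_antisymm (by linarith [sq_nonneg (q₁ t - q₂ t)]) (sq_nonneg _)
    exact sub_eq_zero.1 (pow_eq_zero_iff two_ne_zero |>.1 this)

/-- For every initial state there is a motion defined for all `t ≥ t₀`: motions on the intervals
`[t₀, T]` agree where they overlap. -/
theorem exists_isSolution_forall {l g μ t₀ : ℝ} {a : ℝ → ℝ} (hl : 0 < l) (hg : 0 < g)
    (hμ : 0 < μ) (ha : Continuous a) (q₀ p₀ : ℝ) :
    ∃ q p : ℝ → ℝ, q t₀ = q₀ ∧ p t₀ = p₀ ∧
      ∀ T, t₀ ≤ T → IsApproxSolution l g μ 0 a t₀ T q p := by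
  choose! q p hq hp hsol using fun T (hT : t₀ ≤ T) =>
    exists_isSolution hl hg hμ ha hT q₀ p₀
  refine ⟨fun t => q t t, fun t => p t t, hq _ le_rfl, hp _ le_rfl, fun T hT => ?_⟩
  have key : ∀ t ∈ Icc t₀ T, q T t = q t t ∧ p T t = p t t := by
    intro t ht
    have := ((hsol T hT).mono ht.1 ht.2).eqOn hl hg hμ ha (hsol t ht.1)
      (by rw [hq T hT, hq t ht.1]) (by rw [hp T hT, hp t ht.1])
    exact ⟨this.1 ⟨ht.1, le_rfl⟩, this.2 ⟨ht.1, le_rfl⟩⟩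
  exact (hsol T hT).congr hT (fun t ht => (key t ht).1) (fun t ht => (key t ht).2)

theorem IsInclusionSolution.isApproxSolution {l g μ t₀ T : ℝ} {ξ : ℝ → ℝ} {J : Set ℝ}
    {y : ℝ → ℝ × ℝ} (hl : 0 < l) (hμ : 0 < μ)
    (hy : IsInclusionSolution (pendulumInclusion l g μ ξ) J y) (h0 : t₀ ∈ J) (hT : T ∈ J) :
    IsApproxSolution l g μ 0 (deriv (deriv ξ)) t₀ T (fun t => (y t).1) (fun t => (y t).2) := by
  have hAC := hy.absCont t₀ h0 T hT
  refine ⟨hAC.of_dist_le fun s t => ?_, hAC.of_dist_le fun s t => ?_, ?_⟩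
  · rw [Prod.dist_eq (x := y s)]; exact le_max_left _ _
  · rw [Prod.dist_eq (x := y s)]; exact le_max_right _ _
  · filter_upwards [hy.inclusion] with t ht hm
    obtain ⟨v, hv, hd⟩ := ht (hy.interval.out h0 hT hm)
    obtain ⟨h1, h2⟩ := frictionLaw_of_mem_pendulumInclusion hl hμ hv
    exact ⟨h1 ▸ hd.fst, _, hd.snd, h2⟩

theorem isInclusionSolution_Ici {l g μ t₀ : ℝ} {ξ q p : ℝ → ℝ} (hl : 0 < l) (hμ : 0 < μ)
    (h : ∀ T, t₀ ≤ T → IsApproxSolution l g μ 0 (deriv (deriv ξ)) t₀ T q p) :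
    IsInclusionSolution (pendulumInclusion l g μ ξ) (Ici t₀) (fun t => (q t, p t)) := by
  refine ⟨ordConnected_Ici, fun a ha b hb => ?_, ?_⟩
  · have hT : t₀ ≤ max a b := le_max_of_le_left ha
    have hsub : uIcc a b ⊆ uIcc t₀ (max a b) := by
      rw [uIcc_of_le hT]
      exact Icc_subset_Icc (le_inf ha hb) le_rfl
    exact ((h _ hT).absCont_fst.mono hsub).prodMk ((h _ hT).absCont_snd.mono hsub)
  · have hall : ∀ᵐ t : ℝ, ∀ n : ℕ, t ∈ Icc t₀ (t₀ + n) → HasDerivAt q (p t) t ∧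
        ∃ d, HasDerivAt p d t ∧ FrictionLaw l g μ 0 (deriv (deriv ξ) t) (q t) (p t) d :=
      ae_all_iff.2 fun n => (h _ (by simp)).ae_law
    filter_upwards [hall] with t ht hm
    obtain ⟨n, hn⟩ := exists_nat_ge (t - t₀)
    obtain ⟨h1, d, h2, h3⟩ := ht n ⟨hm, by linarith⟩
    exact ⟨(p t, d), h3.mem_pendulumInclusion hl hμ, h1.prodMk h2⟩

/-! ### Leaving the upper half-plane -/

theorem AbsolutelyContinuousOnInterval.sub_le_mul_sub {u : ℝ → ℝ} {s t c : ℝ} (hst : s ≤ t)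
    (hu : AbsolutelyContinuousOnInterval u s t)
    (hd : ∀ᵐ τ : ℝ, τ ∈ Icc s t → ∃ d, HasDerivAt u d τ ∧ d ≤ c) : u t - u s ≤ c * (t - s) := by
  have hc : AbsolutelyContinuousOnInterval (fun τ : ℝ => c * τ) s t := by
    apply ContDiffOn.absolutelyContinuousOnInterval
    fun_prop
  have := (hu.sub hc).le_exp_mul (K := 0) (by
    filter_upwards [hd] with τ hτ hm
    obtain ⟨d, h1, h2⟩ := hτ hm
    exact ⟨_, h1.sub ((hasDerivAt_id τ).const_mul c), by linarith⟩) ⟨hst, le_rfl⟩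
  simp only [zero_mul, Real.exp_zero, one_mul, Pi.sub_apply] at this
  linarith

namespace IsApproxSolution

variable {l g μ ε t₀ T : ℝ} {a q p : ℝ → ℝ}

/-- The reflection in the vertical line exchanges the two horizontal positions. -/
theorem reflect (h : IsApproxSolution l g μ ε a t₀ T q p) :
    IsApproxSolution l g μ ε (fun t => -a t) t₀ T (fun t => Real.pi - q t) (fun t => -p t) := by
  have hc : AbsolutelyContinuousOnInterval (fun _ : ℝ => Real.pi) t₀ T :=
    ContDiffOn.absolutelyContinuousOnInterval contDiffOn_const
  refine ⟨hc.sub h.absCont_fst, h.absCont_snd.neg, ?_⟩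
  filter_upwards [h.ae_law] with t ht hm
  obtain ⟨h1, d, h2, h3⟩ := ht hm
  refine ⟨h1.const_sub _, -d, h2.neg, ?_⟩
  have eD : pendulumDrive l g (-a t) (Real.pi - q t) - -d =
      -(pendulumDrive l g (a t) (q t) - d) := by
    unfold pendulumDrive
    rw [Real.sin_pi_sub, Real.cos_pi_sub]
    ring
  have eC : frictionCap l g μ (-a t) (Real.pi - q t) (-p t) =
      frictionCap l g μ (a t) (q t) (p t) := by
    unfold frictionCap
    rw [Real.sin_pi_sub, Real.cos_pi_sub, neg_mul_neg, neg_sq]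
  refine ⟨?_, ?_, ?_⟩
  · rw [eD, eC, abs_neg]; exact h3.abs_le
  · rw [eD, neg_mul_neg]; exact h3.nonneg
  · rw [eD, eC, neg_mul_neg, abs_neg]; exact h3.cap_mul_le

theorem continuousOn_fst (h0T : t₀ ≤ T) (h : IsApproxSolution l g μ ε a t₀ T q p) :
    ContinuousOn q (Icc t₀ T) := uIcc_of_le h0T ▸ h.absCont_fst.continuousOn

theorem continuousOn_snd (h0T : t₀ ≤ T) (h : IsApproxSolution l g μ ε a t₀ T q p) :
    ContinuousOn p (Icc t₀ T) := uIcc_of_le h0T ▸ h.absCont_snd.continuousOn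

theorem fst_sub_le (h : IsApproxSolution l g μ ε a t₀ T q p) {s t c : ℝ} (h0s : t₀ ≤ s)
    (hst : s ≤ t) (htT : t ≤ T) (hc : ∀ τ ∈ Icc s t, p τ ≤ c) : q t - q s ≤ c * (t - s) := by
  have hu : uIcc s t ⊆ uIcc t₀ T := by
    rw [uIcc_of_le hst, uIcc_of_le (h0s.trans (hst.trans htT))]
    exact Icc_subset_Icc h0s htT
  refine (h.absCont_fst.mono hu).sub_le_mul_sub hst ?_
  filter_upwards [h.ae_law] with τ hτ hm
  exact ⟨_, (hτ (Icc_subset_Icc h0s htT hm)).1, hc τ hm⟩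

theorem fst_lt_of_snd_neg (h : IsApproxSolution l g μ ε a t₀ T q p) {s t : ℝ} (h0s : t₀ ≤ s)
    (hst : s < t) (htT : t ≤ T) (hs : p s ≤ 0) (hp : ∀ τ ∈ Ioc s t, p τ < 0) : q t < q s := by
  have h0T : t₀ ≤ T := h0s.trans (hst.le.trans htT)
  have hm1 : s < (s + t) / 2 := by linarith
  have hm2 : (s + t) / 2 < t := by linarith
  obtain ⟨σ, hσ, hmax⟩ := isCompact_Icc.exists_isMaxOn (nonempty_Icc.2 hm2.le)
    ((h.continuousOn_snd h0T).mono (Icc_subset_Icc (h0s.trans hm1.le) htT))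
  have h1 := h.fst_sub_le (h0s.trans hm1.le) hm2.le htT (c := p σ) fun τ hτ => hmax hτ
  have h2 := h.fst_sub_le h0s hm1.le (hm2.le.trans htT) (c := 0) fun τ hτ => by
    rcases hτ.1.eq_or_lt with h | h
    · exact h ▸ hs
    · exact (hp τ ⟨h, hτ.2.trans hm2.le⟩).le
  have h3 := hp σ ⟨hm1.trans_le hσ.1, hσ.2⟩
  nlinarith

/-- The smallness of the acceleration enters here: a rod at rest in the horizontal position `q = 0`
falls, since friction cannot hold it against gravity. -/
theorem eventually_snd_neg (hl : 0 < l) (ha : Continuous a)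
    (h : IsApproxSolution l g μ ε a t₀ T q p) {τ : ℝ} (h0τ : t₀ ≤ τ) (hτT : τ < T)
    (hq : q τ = 0) (hp : p τ ≤ 0) (hsmall : μ * |a τ| < g) : ∀ᶠ t in 𝓝[>] τ, p t < 0 := by
  have h0T : t₀ ≤ T := h0τ.trans hτT.le
  have hτ : τ ∈ Icc t₀ T := ⟨h0τ, hτT.le⟩
  have hsub : Ioc τ T ⊆ Icc t₀ T := fun t ht => ⟨h0τ.trans ht.1.le, ht.2⟩
  have hle : 𝓝[>] τ ≤ 𝓝[Icc t₀ T] τ := by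
    rw [← nhdsWithin_Ioc_eq_nhdsGT hτT]
    exact nhdsWithin_mono _ hsub
  have hcp : Tendsto p (𝓝[>] τ) (𝓝 (p τ)) := (h.continuousOn_snd h0T τ hτ).mono_left hle
  have hcq : Tendsto q (𝓝[>] τ) (𝓝 (q τ)) := (h.continuousOn_fst h0T τ hτ).mono_left hle
  -- if `p τ = 0`, the largest admissible acceleration at `τ` is `(μ * |a τ| - g) / l < 0`
  rcases hp.lt_or_eq with hp | hp
  · exact hcp.eventually (gt_mem_nhds hp)
  · have hca : Tendsto a (𝓝[>] τ) (𝓝 (a τ)) := (ha.tendsto τ).mono_left nhdsWithin_le_nhds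
    have hF := (((continuous_pendulumDrive l g).tendsto (a τ, q τ)).comp (hca.prodMk_nhds hcq)).add
      (((continuous_frictionCap l g μ).tendsto (a τ, q τ, p τ)).comp
        (hca.prodMk_nhds (hcq.prodMk_nhds hcp)))
    have hval : pendulumDrive l g (a τ) (q τ) + frictionCap l g μ (a τ) (q τ) (p τ) < 0 := by
      unfold pendulumDrive frictionCap
      rw [hq, hp]
      simp only [Real.sin_zero, Real.cos_zero]
      have : a τ / l * 0 - g / l * 1 + μ / l * |a τ * 1 - l * 0 ^ 2 + g * 0| =
          (μ * |a τ| - g) / l := by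
        simp only [mul_one, mul_zero, add_zero]
        rw [zero_pow two_ne_zero, mul_zero, sub_zero]
        ring
      rw [this]
      exact div_neg_of_neg_of_pos (by linarith) hl
    obtain ⟨c, hc1, hc2⟩ := exists_between hval
    have hev := hF.eventually (gt_mem_nhds hc1)
    obtain ⟨b, hb, hbs⟩ := (mem_nhdsGT_iff_exists_Ioo_subset' hτT).1 hev
    filter_upwards [Ioo_mem_nhdsGT (lt_min hb hτT)] with t ht
    have htT : t ≤ T := (ht.2.trans_le (min_le_right _ _)).le
    have htb : t < b := ht.2.trans_le (min_le_left _ _)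
    have hu : uIcc τ t ⊆ uIcc t₀ T := by
      rw [uIcc_of_le ht.1.le, uIcc_of_le h0T]
      exact Icc_subset_Icc h0τ htT
    have := (h.absCont_snd.mono hu).sub_le_mul_sub (c := c) ht.1.le (by
      filter_upwards [h.ae_law, ae_mem_Ioo_of_mem_Icc τ t] with σ hσ hI hm
      obtain ⟨-, d, h2, h3⟩ := hσ (Icc_subset_Icc h0τ htT hm)
      have h4 : pendulumDrive l g (a σ) (q σ) + frictionCap l g μ (a σ) (q σ) (p σ) < c :=
        hbs ⟨(hI hm).1, (hI hm).2.trans htb⟩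
      exact ⟨d, h2, by linarith [(_root_.abs_le.1 h3.abs_le).1]⟩)
    have h5 : c * (t - τ) < 0 := mul_neg_of_neg_of_pos hc2 (sub_pos.2 ht.1)
    linarith

theorem eventually_fst_neg (hl : 0 < l) (ha : Continuous a)
    (h : IsApproxSolution l g μ ε a t₀ T q p) {τ : ℝ} (h0τ : t₀ ≤ τ) (hτT : τ < T)
    (hq : q τ = 0) (hp : p τ ≤ 0) (hsmall : μ * |a τ| < g) : ∀ᶠ t in 𝓝[>] τ, q t < 0 := by
  obtain ⟨b, hb, hbs⟩ := (mem_nhdsGT_iff_exists_Ioo_subset' hτT).1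
    (h.eventually_snd_neg hl ha h0τ hτT hq hp hsmall)
  filter_upwards [Ioo_mem_nhdsGT (lt_min hb hτT)] with t ht
  have htT : t ≤ T := (ht.2.trans_le (min_le_right _ _)).le
  have htb : t < b := ht.2.trans_le (min_le_left _ _)
  rw [← hq]
  exact h.fst_lt_of_snd_neg h0τ ht.1 htT hp fun σ hσ => hbs ⟨hσ.1, hσ.2.trans_lt htb⟩

theorem snd_nonpos_of_pos_before (h : IsApproxSolution l g μ ε a t₀ T q p) {τ : ℝ}
    (h0τ : t₀ < τ) (hτT : τ ≤ T) (hq : q τ = 0) (hpos : ∀ σ ∈ Ico t₀ τ, 0 < q σ) : p τ ≤ 0 := by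
  by_contra! hp
  have h0T : t₀ ≤ T := h0τ.le.trans hτT
  have hle : 𝓝[<] τ ≤ 𝓝[Icc t₀ T] τ := by
    rw [← nhdsWithin_Ico_eq_nhdsLT h0τ]
    exact nhdsWithin_mono _ fun t ht => ⟨ht.1, ht.2.le.trans hτT⟩
  have hev : ∀ᶠ t in 𝓝[<] τ, 0 < p t :=
    ((h.continuousOn_snd h0T τ ⟨h0τ.le, hτT⟩).mono_left hle).eventually (lt_mem_nhds hp)
  obtain ⟨b, hb, hbs⟩ := (mem_nhdsLT_iff_exists_Ioo_subset' h0τ).1 hev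
  obtain ⟨t, ht1, ht2⟩ := exists_between (max_lt hb h0τ)
  have htb : b < t := (le_max_left _ _).trans_lt ht1
  have h0t : t₀ < t := (le_max_right _ _).trans_lt ht1
  have hr := h.reflect.fst_sub_le (c := 0) h0t.le ht2.le hτT fun σ hσ => by
    rcases hσ.2.eq_or_lt with h | h
    · rw [h]; linarith
    · have : 0 < p σ := hbs ⟨htb.trans_le hσ.1, h⟩
      linarith
  have := hpos t ⟨h0t.le, ht2⟩
  linarith

/-- A motion that is positive before the time `τ` and reaches `0` at that time crosses `0`. If it
starts at `0`, it must not start inwards. -/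
theorem eventually_fst_neg_of_pos_before (hl : 0 < l) (ha : Continuous a)
    (h : IsApproxSolution l g μ ε a t₀ T q p) (h0 : q t₀ = 0 → p t₀ ≤ 0) {τ : ℝ} (h0τ : t₀ ≤ τ)
    (hτT : τ < T) (hsmall : μ * |a τ| < g) (hpos : ∀ σ ∈ Ico t₀ τ, 0 < q σ) (hq : q τ = 0) :
    ∀ᶠ t in 𝓝[>] τ, q t < 0 := by
  refine h.eventually_fst_neg hl ha h0τ hτT hq ?_ hsmall
  rcases h0τ.eq_or_lt with rfl | h'
  · exact h0 hq
  · exact h.snd_nonpos_of_pos_before h' hτT.le hq hpos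

end IsApproxSolution

/-- A curve that can leave `(0, c)` only by crossing an end either stays in `(0, c)` forever, or
crosses `0` before reaching `c`, or crosses `c` before reaching `0`. -/
theorem stays_or_crosses {q : ℝ → ℝ} {t₀ c : ℝ} (hc : 0 < c) (hq : ContinuousOn q (Ici t₀))
    (h0 : q t₀ ∈ Icc 0 c)
    (hl : ∀ τ, t₀ ≤ τ → (∀ σ ∈ Ico t₀ τ, q σ ∈ Ioo 0 c) → q τ = 0 → ∀ᶠ t in 𝓝[>] τ, q t < 0)
    (hr : ∀ τ, t₀ ≤ τ → (∀ σ ∈ Ico t₀ τ, q σ ∈ Ioo 0 c) → q τ = c → ∀ᶠ t in 𝓝[>] τ, c < q t) :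
    (∀ t, t₀ ≤ t → q t ∈ Ioo 0 c) ∨ (∃ t, t₀ ≤ t ∧ q t < 0 ∧ ∀ σ ∈ Icc t₀ t, q σ < c) ∨
      (∃ t, t₀ ≤ t ∧ c < q t ∧ ∀ σ ∈ Icc t₀ t, 0 < q σ) := by
  by_cases hall : ∀ t, t₀ ≤ t → q t ∈ Ioo 0 c
  · exact Or.inl hall
  right
  push Not at hall
  obtain ⟨t₁, h01, ht₁⟩ := hall
  -- the first time outside of `(0, c)`
  have hcl : IsClosed (Icc t₀ t₁ ∩ q ⁻¹' (Ioo 0 c)ᶜ) :=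
    (hq.mono Icc_subset_Ici_self).preimage_isClosed_of_isClosed isClosed_Icc
      isOpen_Ioo.isClosed_compl
  obtain ⟨τ, ⟨hτI, hτ⟩, hmin⟩ :=
    (isCompact_Icc.of_isClosed_subset hcl inter_subset_left).exists_isLeast ⟨t₁, ⟨h01, le_rfl⟩, ht₁⟩
  have hbefore : ∀ σ ∈ Ico t₀ τ, q σ ∈ Ioo 0 c := fun σ hσ => by
    by_contra hn
    exact absurd (hmin ⟨⟨hσ.1, hσ.2.le.trans hτI.2⟩, hn⟩) (not_le.2 hσ.2)
  have hτc : q τ ∈ Icc 0 c := by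
    rcases hτI.1.eq_or_lt with h | h
    · exact h ▸ h0
    · have : τ ∈ closure (Ico t₀ τ) := by
        rw [closure_Ico h.ne]; exact ⟨h.le, le_rfl⟩
      have hcont : ContinuousWithinAt q (Ico t₀ τ) τ := (hq τ hτI.1).mono Ico_subset_Ici_self
      rw [← closure_Ioo hc.ne]
      exact hcont.mem_closure this hbefore
  have hends : q τ = 0 ∨ q τ = c := by
    by_contra! hn
    exact hτ ⟨lt_of_le_of_ne hτc.1 hn.1.symm, lt_of_le_of_ne hτc.2 hn.2⟩
  rcases hends with he | he
  · left
    obtain ⟨b, hb, hbs⟩ := mem_nhdsGT_iff_exists_Ioo_subset.1 (hl τ hτI.1 hbefore he)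
    obtain ⟨t, ht1, ht2⟩ := exists_between (show τ < b from hb)
    refine ⟨t, hτI.1.trans ht1.le, hbs ⟨ht1, ht2⟩, fun σ hσ => ?_⟩
    rcases lt_trichotomy σ τ with h | h | h
    · exact (hbefore σ ⟨hσ.1, h⟩).2
    · rw [h, he]; exact hc
    · exact lt_trans (show q σ < 0 from hbs ⟨h, hσ.2.trans_lt ht2⟩) hc
  · right
    obtain ⟨b, hb, hbs⟩ := mem_nhdsGT_iff_exists_Ioo_subset.1 (hr τ hτI.1 hbefore he)
    obtain ⟨t, ht1, ht2⟩ := exists_between (show τ < b from hb)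
    refine ⟨t, hτI.1.trans ht1.le, hbs ⟨ht1, ht2⟩, fun σ hσ => ?_⟩
    rcases lt_trichotomy σ τ with h | h | h
    · exact (hbefore σ ⟨hσ.1, h⟩).1
    · rw [h, he]; exact hc
    · exact lt_trans hc (show c < q σ from hbs ⟨h, hσ.2.trans_lt ht2⟩)

theorem isOpen_setOf_crosses_zero_first {Q : ℝ → ℝ → ℝ} {t₀ c : ℝ}
    (hQ : ∀ s, ContinuousOn (Q s) (Ici t₀))
    (hdep : ∀ s T η, t₀ ≤ T → 0 < η → ∀ᶠ s' in 𝓝 s, ∀ t ∈ Icc t₀ T, |Q s' t - Q s t| < η) :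
    IsOpen {s | ∃ t, t₀ ≤ t ∧ Q s t < 0 ∧ ∀ σ ∈ Icc t₀ t, Q s σ < c} := by
  rw [isOpen_iff_mem_nhds]
  rintro s ⟨t, h0t, ht, hlt⟩
  obtain ⟨σ, hσ, hmax⟩ := isCompact_Icc.exists_isMaxOn (nonempty_Icc.2 h0t)
    ((hQ s).mono Icc_subset_Ici_self)
  have hη : 0 < min (-Q s t) (c - Q s σ) := lt_min (by linarith) (sub_pos.2 (hlt σ hσ))
  filter_upwards [hdep s t _ h0t hη] with s' hs'
  refine ⟨t, h0t, ?_, fun τ hτ => ?_⟩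
  · have h1 := (abs_lt.1 (hs' t ⟨h0t, le_rfl⟩)).2
    linarith [min_le_left (-Q s t) (c - Q s σ)]
  · have h1 := (abs_lt.1 (hs' τ hτ)).2
    have h2 : Q s τ ≤ Q s σ := hmax hτ
    linarith [min_le_right (-Q s t) (c - Q s σ)]

/-- The motions with initial states on a line depend continuously on the initial state, uniformly
on bounded intervals of time. -/
theorem eventually_forall_abs_fst_sub_lt {l g μ t₀ T η : ℝ} {a : ℝ → ℝ} {Q V : ℝ → ℝ → ℝ}
    (hl : 0 < l) (hg : 0 < g) (hμ : 0 < μ) (ha : Continuous a)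
    (h : ∀ s, IsApproxSolution l g μ 0 a t₀ T (Q s) (V s))
    (hQ : Continuous fun s => Q s t₀) (hV : Continuous fun s => V s t₀) (hη : 0 < η) (s : ℝ) :
    ∀ᶠ s' in 𝓝 s, ∀ t ∈ Icc t₀ T, |Q s' t - Q s t| < η := by
  obtain ⟨A, hA⟩ : ∃ A, ∀ t ∈ Icc t₀ T, |a t| ≤ A :=
    isCompact_Icc.exists_bound_of_continuousOn ha.continuousOn
  set R := |V s t₀| + 1
  set P := speedBound R ((A + g) / l) (T - t₀)
  set K := 1 + (1 + μ) * ((A + g) / l) + 4 * μ * P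
  have hR : ∀ᶠ s' in 𝓝 s, |V s' t₀| < R :=
    (hV.abs.tendsto s).eventually (gt_mem_nhds (by linarith))
  have hE : ∀ᶠ s' in 𝓝 s, Real.exp (|K| * (T - t₀)) *
      ((Q s' t₀ - Q s t₀) ^ 2 + (V s' t₀ - V s t₀) ^ 2) < η ^ 2 := by
    have hc : Continuous fun s' => Real.exp (|K| * (T - t₀)) *
      ((Q s' t₀ - Q s t₀) ^ 2 + (V s' t₀ - V s t₀) ^ 2) := by fun_prop
    refine (hc.tendsto s).eventually (gt_mem_nhds ?_)
    simp only [sub_self]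
    rw [zero_pow two_ne_zero, add_zero, mul_zero]
    positivity
  filter_upwards [hR, hE] with s' hs' hE' t ht
  have key := (h s').dist_sq_le hl hg hμ le_rfl le_rfl hA (h s)
    (fun τ hτ => (h s').abs_snd_le hl hg hA hs'.le hτ)
    (fun τ hτ => (h s).abs_snd_le hl hg hA (show _ ≤ R by linarith) hτ) ht
  simp only [add_zero, mul_zero] at key
  have h1 : Real.exp (K * (t - t₀)) ≤ Real.exp (|K| * (T - t₀)) := by
    have := le_abs_self K
    have h2 : t ≤ T := ht.2
    have h3 : 0 ≤ t - t₀ := sub_nonneg.2 ht.1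
    gcongr
  have h2 : (Q s' t - Q s t) ^ 2 < η ^ 2 := by
    have h3 : 0 ≤ (Q s' t₀ - Q s t₀) ^ 2 + (V s' t₀ - V s t₀) ^ 2 := by positivity
    have h4 := mul_le_mul_of_nonneg_right h1 h3
    have h5 := sq_nonneg (V s' t - V s t)
    linarith
  exact abs_lt_of_sq_lt_sq h2 hη.le

/-! ### Existence of a motion that never falls -/

theorem proposition2 (l g μ : ℝ) (hl : 0 < l) (hg : 0 < g) (hμ : 0 < μ)
    (ξ : ℝ → ℝ) (hξ : Differentiable ℝ ξ) (hξ' : Differentiable ℝ (deriv ξ))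
    (hLip : ∃ K, LipschitzWith K (deriv (deriv ξ)))
    (t₀ : ℝ) (hsmall : ∀ t, t₀ ≤ t → μ * |deriv (deriv ξ) t| < g) :
    ∃ q₀ ∈ Ioo (0 : ℝ) Real.pi, ∃ p₀ : ℝ, ∃ q p : ℝ → ℝ,
      -- `(q, p)` is a solution for all `t ≥ t₀` with the initial conditions `(q₀, p₀)`
      IsInclusionSolution (pendulumInclusion l g μ ξ) (Ici t₀) (fun t => (q t, p t)) ∧
      q t₀ = q₀ ∧ p t₀ = p₀ ∧
      -- it is the only one: any solution with these initial conditions is a part of it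
      (∀ (J : Set ℝ) (y : ℝ → ℝ × ℝ), t₀ ∈ J →
        IsInclusionSolution (pendulumInclusion l g μ ξ) J y → y t₀ = (q₀, p₀) →
        ∀ t ∈ J, t₀ ≤ t → y t = (q t, p t)) ∧
      -- the pendulum never falls
      ∀ t, t₀ < t → q t ∈ Ioo (0 : ℝ) Real.pi := by
  have ha : Continuous (deriv (deriv ξ)) := hLip.choose_spec.continuous
  have hπ := Real.pi_pos
  -- the initial states `(0, -1)` and `(π, 1)` at the ends of the segment leave `[0, π]` at once
  choose Q V hQ0 hV0 hsol using fun s : ℝ =>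
    exists_isSolution_forall (t₀ := t₀) hl hg hμ ha (Real.pi * s) (2 * s - 1)
  have hcont : ∀ s, ContinuousOn (Q s) (Ici t₀) := fun s t ht => by
    have h1 : t₀ ≤ t + 1 := by linarith [mem_Ici.1 ht]
    have h2 := (hsol s (t + 1) h1).continuousOn_fst h1 t ⟨ht, by linarith⟩
    refine h2.mono_of_mem_nhdsWithin ?_
    rw [← Ici_inter_Iic]
    exact inter_mem self_mem_nhdsWithin (mem_nhdsWithin_of_mem_nhds (Iic_mem_nhds (by linarith)))
  have hdep : ∀ s T η, t₀ ≤ T → 0 < η →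
      ∀ᶠ s' in 𝓝 s, ∀ t ∈ Icc t₀ T, |Q s' t - Q s t| < η := fun s T η hT hη =>
    eventually_forall_abs_fst_sub_lt hl hg hμ ha (fun s => hsol s T hT)
      (by simp only [hQ0]; fun_prop) (by simp only [hV0]; fun_prop) hη s
  have htri := fun (s : ℝ) (hs : s ∈ Icc (0 : ℝ) 1) =>
    stays_or_crosses (q := Q s) hπ (hcont s)
      (by rw [hQ0]; exact ⟨mul_nonneg hπ.le hs.1, mul_le_of_le_one_right hπ.le hs.2⟩)
      (fun τ hτ hb hq => (hsol s (τ + 1) (by linarith)).eventually_fst_neg_of_pos_before hl ha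
        (fun h0 => by
          rw [hQ0] at h0
          have : s = 0 := by simpa [hπ.ne'] using h0
          rw [hV0, this]; norm_num)
        hτ (by linarith) (hsmall τ hτ) (fun σ hσ => (hb σ hσ).1) hq)
      (fun τ hτ hb hq => by
        have := (hsol s (τ + 1) (by linarith)).reflect.eventually_fst_neg_of_pos_before hl ha.neg
          (fun h0 => by
            rw [hQ0] at h0
            have : s = 1 := by
              have : Real.pi * (1 - s) = 0 := by linarith
              rcases mul_eq_zero.1 this with h | h <;> linarith
            rw [hV0, this]; norm_num)
          hτ (by linarith) (by rw [Pi.neg_apply, abs_neg]; exact hsmall τ hτ)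
          (fun σ hσ => sub_pos.2 (hb σ hσ).2) (by rw [hq, sub_self])
        filter_upwards [this] with t ht
        linarith)
  set U := {s | ∃ t, t₀ ≤ t ∧ Q s t < 0 ∧ ∀ σ ∈ Icc t₀ t, Q s σ < Real.pi} with hU
  set W := {s | ∃ t, t₀ ≤ t ∧ Real.pi < Q s t ∧ ∀ σ ∈ Icc t₀ t, 0 < Q s σ} with hW
  have hUo : IsOpen U := isOpen_setOf_crosses_zero_first hcont hdep
  have hWo : IsOpen W := by
    have := isOpen_setOf_crosses_zero_first (Q := fun s t => Real.pi - Q s t) (t₀ := t₀)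
      (c := Real.pi) (fun s => continuousOn_const.sub (hcont s)) (fun s T η hT hη => by
        filter_upwards [hdep s T η hT hη] with s' hs' t ht
        rw [sub_sub_sub_cancel_left, abs_sub_comm]
        exact hs' t ht)
    simpa [hW] using this
  obtain ⟨s, -, hstay⟩ : ∃ s ∈ Icc (0 : ℝ) 1, ∀ t, t₀ ≤ t → Q s t ∈ Ioo 0 Real.pi := by
    by_contra! hno
    have hcover : ∀ s ∈ Icc (0 : ℝ) 1, s ∈ U ∨ s ∈ W := fun s hs => by
      rcases htri s hs with h | h | h
      · obtain ⟨t, ht, hn⟩ := hno s hs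
        exact absurd (h t ht) hn
      · exact Or.inl h
      · exact Or.inr h
    have h0U : (0 : ℝ) ∈ U := (hcover 0 (by simp)).resolve_right fun ⟨t, ht, _, h⟩ => by
      have := h t₀ ⟨le_rfl, ht⟩
      rw [hQ0, mul_zero] at this
      exact lt_irrefl _ this
    have h1W : (1 : ℝ) ∈ W := (hcover 1 (by simp)).resolve_left fun ⟨t, ht, _, h⟩ => by
      have := h t₀ ⟨le_rfl, ht⟩
      rw [hQ0, mul_one] at this
      exact lt_irrefl _ this
    obtain ⟨s, -, ⟨t, ht, h1, h2⟩, ⟨t', ht', h1', h2'⟩⟩ :=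
      isPreconnected_Icc U W hUo hWo hcover ⟨0, by simp, h0U⟩ ⟨1, by simp, h1W⟩
    rcases le_total t t' with h | h
    · exact lt_asymm h1 (h2' t ⟨ht, h⟩)
    · exact lt_asymm h1' (h2 t' ⟨ht', h⟩)
  refine ⟨Q s t₀, hstay t₀ le_rfl, V s t₀, Q s, V s, isInclusionSolution_Ici hl hμ (hsol s), rfl,
    rfl, fun J y h0 hy hy0 t ht h0t => ?_, fun t ht => hstay t ht.le⟩
  have := (hy.isApproxSolution hl hμ h0 ht).eqOn hl hg hμ ha (hsol s t h0t) (by rw [hy0])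
    (by rw [hy0])
  exact Prod.ext (this.1 ⟨h0t, le_rfl⟩) (this.2 ⟨h0t, le_rfl⟩)
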